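/- Let $D \subset \mathbb{R}^m$, $m \ge 2$, be a bounded domain (a non-empty, open, connected set), let $\mu > 0$, and let $v \in C^0(D)$ be real-valued. For a ball $B_r(x)=\{y : |y-x|<r\}$ with $\overline{B_r(x)} \subset D$ put $$\widetilde M^\circ(v,x,r)=\frac{1}{|\partial B_r|}\int_{\partial B_r(x)} v\,dS,\qquad \widetilde M^\bullet(v,x,r)=\frac{1}{|B_r|}\int_{B_r(x)} v\,dy,$$ where $|\partial B_r| = 2\pi^{m/2}r^{m-1}/\Gamma(m/2)$ and $|B_r|$ is the volume of the ball, and let $I_\nu(z)=\sum_{k\ge 0}\frac{(z/2)^{2k+\nu}}{k!\,\Gamma(k+\nu+1)}$ be the modified Bessel function of order $\nu$. Suppose that for every $x\in D$ there is given a number $r(x)>0$ with $\overline{B_{r(x)}(x)}\subset D$, and that $$m\, I_{m/2}(\mu r)\,\widetilde M^\circ(v,x,r)=\mu r\, I_{(m-2)/2}(\mu r)\,\widetilde M^\bullet(v,x,r)$$ holds for all $x\in D$ and all $r\in(0,r(x))$. Then $v$ is a solution of the modified Helmholtz equation in $D$, that is, $v\in C^2(D)$ and $\nabla^2 v-\mu^2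 v=0$ in $D$. -/

import Mathlib

open MeasureTheory Metric
open scoped InnerProductSpace

noncomputable section

/-- The modified Bessel function of the first kind of real order `ν`, for positive arguments `z`:
`I_ν(z) = ∑ₖ (z / 2) ^ (2 k + ν) / (k! Γ(k + ν + 1))`. -/
def besselI (ν z : ℝ) : ℝ :=
  ∑' k : ℕ, (z / 2) ^ (2 * (k : ℝ) + ν) / ((k.factorial : ℝ) * Real.Gamma ((k : ℝ) + ν + 1))

/-- The area `|∂B_r| = 2 π^(m/2) r^(m-1) / Γ(m/2)` of a sphere of radius `r` in `ℝ^m`. -/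
def sphereArea (m : ℕ) (r : ℝ) : ℝ :=
  2 * Real.pi ^ ((m : ℝ) / 2) * r ^ (m - 1) / Real.Gamma ((m : ℝ) / 2)

/-- The surface integral `∫_{∂B_r(x)} v dS`, written over the unit sphere with its surface measure
`volume.toSphere` through the parametrization `θ ↦ x + r θ`, for which `dS = r^(m-1) dθ`. -/
def sphereIntegral {m : ℕ} (v : EuclideanSpace ℝ (Fin m) → ℝ) (x : EuclideanSpace ℝ (Fin m))
    (r : ℝ) : ℝ :=
  r ^ (m - 1) *
    ∫ θ : sphere (0 : EuclideanSpace ℝ (Fin m)) 1, v (x + r • (θ : EuclideanSpace ℝ (Fin m)))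
      ∂(volume : Measure (EuclideanSpace ℝ (Fin m))).toSphere

/-- The mean value of `v` over the sphere `∂B_r(x)`. -/
def sphereMean {m : ℕ} (v : EuclideanSpace ℝ (Fin m) → ℝ) (x : EuclideanSpace ℝ (Fin m))
    (r : ℝ) : ℝ :=
  1 / sphereArea m r * sphereIntegral v x r

/-- The mean value of `v` over the ball `B_r(x)`. -/
def ballMean {m : ℕ} (v : EuclideanSpace ℝ (Fin m) → ℝ) (x : EuclideanSpace ℝ (Fin m))
    (r : ℝ) : ℝ :=
  1 / volume.real (ball x r) * ∫ y in ball x r, v y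

/-- `v` is a (classical, `C²`) solution of the modified Helmholtz equation `∇²v - μ²v = 0` in the
open set `D`. -/
def SolvesModifiedHelmholtz {m : ℕ} (μ : ℝ) (v : EuclideanSpace ℝ (Fin m) → ℝ)
    (D : Set (EuclideanSpace ℝ (Fin m))) : Prop :=
  ContDiffOn ℝ 2 v D ∧ ∀ x ∈ D, Laplacian.laplacian v x - μ ^ 2 * v x = 0

end

/-! Let P(r) be the integral of v over B_r(x), and Q(r) the integral over B_r(0) of a plane wave
exp(μ⟨w,y⟩) with |w| = 1. Expanding the exponential shows that I_{(m-2)/2}(μr) and I_{m/2}(μr) are,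
up to constants and powers of r, the sphere and ball integrals of this plane wave. The hypothesis
thus reads P'Q = PQ'. So P/Q is constant in r, and r → 0 gives P = v(x) Q: on small balls v has the
mean value property of plane waves (`setIntegral_ball_eq_of_mean_relation`).

Since Q exceeds the volume of the ball, this property implies a maximum principle
(`le_of_local_ball_average`). Combinations of plane waves share the property and are uniformly dense
in the continuous functions on every sphere of positive radius
(`exists_planeWaveSpan_approx_on_sphere`), which replaces solving a Dirichlet problem. Indeed, if a
functional Λ on C(∂B_ρ(x₀)) annihilates them, then F(ξ) = Λ(exp⟨ξ, x - x₀⟩) satisfies ΔF = ρ²F and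
vanishes for |ξ| = μ; it vanishes for |ξ| ≤ μ by the maximum principle, everywhere by analyticity,
and then Λ = 0 by Stone–Weierstrass. Matching v on a sphere and applying the maximum principle
inside makes v a uniform limit of plane wave combinations on closed balls.

Convolution with a radial bump multiplies all these plane waves by one constant, hence also v near
the centre, so v is smooth (`contDiffOn_of_planeWaveSpan_approx`). The equation passes to the limit
by comparison with a small quadratic (`laplacian_le_of_planeWaveSpan_approx`). -/

noncomputable section

/-! ### Polar coordinates, rotations and one-dimensional Gaussian moments -/

/-- Integration in polar coordinates. -/
theorem integral_eq_integral_Ioi_sphere {m : ℕ} (hm : 1 ≤ m)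
    (f : EuclideanSpace ℝ (Fin m) → ℝ) (hf : Integrable f) :
    ∫ x, f x = ∫ r in Set.Ioi (0 : ℝ), r ^ (m - 1) *
      ∫ θ : sphere (0 : EuclideanSpace ℝ (Fin m)) 1, f (r • (θ : EuclideanSpace ℝ (Fin m)))
        ∂(volume : Measure (EuclideanSpace ℝ (Fin m))).toSphere := by
  have hdim : Module.finrank ℝ (EuclideanSpace ℝ (Fin m)) = m := by simp
  have : Nontrivial (EuclideanSpace ℝ (Fin m)) := by
    apply Module.nontrivial_of_finrank_pos (R := ℝ)
    omega
  set ν : Measure (EuclideanSpace ℝ (Fin m)) := volume with hν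
  let g : sphere (0 : EuclideanSpace ℝ (Fin m)) 1 × Set.Ioi (0 : ℝ) → ℝ :=
    fun p => f ((p.2 : ℝ) • (p.1 : EuclideanSpace ℝ (Fin m)))
  have hg : ∀ x : ({(0)}ᶜ : Set (EuclideanSpace ℝ (Fin m))),
      g (homeomorphUnitSphereProd _ x) = f x := by
    intro x
    have hx : ‖(x : EuclideanSpace ℝ (Fin m))‖ ≠ 0 := norm_ne_zero_iff.2 x.2
    simp only [g, homeomorphUnitSphereProd_apply_snd_coe, homeomorphUnitSphereProd_apply_fst_coe,
      smul_smul]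
    rw [mul_inv_cancel₀ hx, one_smul]
  have hmp := ν.measurePreserving_homeomorphUnitSphereProd
  rw [hdim] at hmp
  have hemb := Homeomorph.measurableEmbedding
    (homeomorphUnitSphereProd (EuclideanSpace ℝ (Fin m)))
  have hgi : Integrable g (ν.toSphere.prod (Measure.volumeIoiPow (m - 1))) := by
    have h1 := hmp.integrable_comp_emb (g := g) hemb
    rw [← h1]
    have : g ∘ (homeomorphUnitSphereProd (EuclideanSpace ℝ (Fin m))) = fun x => f x.1 := by
      ext x; exact hg x
    rw [this]
    exact (integrableOn_iff_comap_subtypeVal (by measurability)).1 hf.integrableOn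
  calc
    ∫ x, f x ∂ν = ∫ x : ({(0)}ᶜ : Set (EuclideanSpace ℝ (Fin m))), f x ∂(ν.comap (↑)) := by
      rw [integral_subtype_comap (measurableSet_singleton _).compl f, restrict_compl_singleton]
    _ = ∫ p, g p ∂(ν.toSphere.prod (Measure.volumeIoiPow (m - 1))) := by
      rw [← hmp.integral_comp hemb g]
      exact integral_congr_ae (Filter.Eventually.of_forall fun x => (hg x).symm)
    _ = ∫ r : Set.Ioi (0 : ℝ), (∫ θ, g (θ, r) ∂ν.toSphere) ∂(Measure.volumeIoiPow (m - 1)) :=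
      integral_prod_symm g hgi
    _ = _ := by
      simp only [Measure.volumeIoiPow, ENNReal.ofReal]
      rw [integral_withDensity_eq_integral_smul,
        integral_subtype_comap measurableSet_Ioi fun a ↦ Real.toNNReal (a ^ (m - 1)) •
          ∫ θ : sphere (0 : EuclideanSpace ℝ (Fin m)) 1,
            f (a • (θ : EuclideanSpace ℝ (Fin m))) ∂ν.toSphere,
        setIntegral_congr_fun measurableSet_Ioi fun x hx ↦ ?_]
      · rw [NNReal.smul_def, Real.coe_toNNReal _ (pow_nonneg hx.out.le _), smul_eq_mul]
      · exact (measurable_subtype_coe.pow_const _).real_toNNReal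

/-- Extend w to an orthonormal basis with w in position i; e is its coordinate map. This reduces
rotation invariant integrals to a coordinate direction. -/
theorem exists_linearIsometryEquiv_inner {m : ℕ} (i : Fin m) (w : EuclideanSpace ℝ (Fin m))
    (hw : ‖w‖ = 1) :
    ∃ e : EuclideanSpace ℝ (Fin m) ≃ₗᵢ[ℝ] EuclideanSpace ℝ (Fin m),
      ∀ x, inner ℝ w x = e x i := by
  obtain ⟨b, hb⟩ := Orthonormal.exists_orthonormalBasis_extension_of_card_eq (𝕜 := ℝ)
    (E := EuclideanSpace ℝ (Fin m)) (ι := Fin m) (by simp) (v := fun _ => w) (s := {i})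
    (by
      constructor
      · intro j; simpa using hw
      · intro j k hjk
        exact absurd (Subsingleton.elim j k) hjk)
  refine ⟨b.repr, fun x => ?_⟩
  rw [b.repr_apply_apply, hb i rfl]

theorem integral_even_pow_mul_exp_neg_sq (k : ℕ) :
    ∫ x : ℝ, x ^ (2 * k) * Real.exp (-x ^ 2) = Real.Gamma (k + 1 / 2) := by
  have h1 : ∫ x : ℝ, |x| ^ (2 * k) * Real.exp (-|x| ^ 2) = _ :=
    integral_comp_abs (f := fun x => x ^ (2 * k) * Real.exp (-x ^ 2))
  have h2 := integral_rpow_mul_exp_neg_rpow (p := 2) (q := 2 * k) (by norm_num)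
    (by have : (0:ℝ) ≤ k := Nat.cast_nonneg k
        linarith)
  have h3 : ∫ x in Set.Ioi (0:ℝ), x ^ (2 * k) * Real.exp (-x ^ 2) =
      ∫ x in Set.Ioi (0:ℝ), x ^ (2 * (k:ℝ)) * Real.exp (-x ^ (2:ℝ)) := by
    refine setIntegral_congr_fun measurableSet_Ioi fun x _ => ?_
    rw [show (2 * (k:ℝ)) = ((2 * k : ℕ) : ℝ) by push_cast; ring, Real.rpow_natCast,
      Real.rpow_ofNat]
  simp only [(even_two_mul k).pow_abs, sq_abs] at h1
  rw [h1, h3, h2]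
  ring_nf

theorem integrable_pow_mul_exp_neg_sq (k : ℕ) :
    Integrable fun x : ℝ => x ^ k * Real.exp (-x ^ 2) := by
  have := integrable_rpow_mul_exp_neg_mul_sq (b := 1) one_pos (s := k)
    (by have : (0:ℝ) ≤ k := Nat.cast_nonneg k
        linarith)
  simpa [Real.rpow_natCast] using this

/-! ### Moments of a linear form over the unit sphere -/

section Gaussian

variable {m : ℕ}

theorem coord_pow_mul_exp_eq_prod (i : Fin m) (k : ℕ) (x : Fin m → ℝ) :
    (WithLp.toLp 2 x : EuclideanSpace ℝ (Fin m)) i ^ k *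
      Real.exp (-‖(WithLp.toLp 2 x : EuclideanSpace ℝ (Fin m))‖ ^ 2) =
    ∏ j, (x j ^ (if j = i then k else 0) * Real.exp (-(x j) ^ 2)) := by
  rw [Finset.prod_mul_distrib, ← Real.exp_sum, Finset.sum_neg_distrib, EuclideanSpace.norm_sq_eq]
  congr 1
  · simp [pow_ite]
  · simp

theorem integrable_inner_pow_mul_gaussian (i : Fin m) (w : EuclideanSpace ℝ (Fin m))
    (hw : ‖w‖ = 1) (k : ℕ) :
    Integrable fun x : EuclideanSpace ℝ (Fin m) => inner ℝ w x ^ k * Real.exp (-‖x‖ ^ 2) := by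
  obtain ⟨e, he⟩ := exists_linearIsometryEquiv_inner i w hw
  have h1 : Integrable fun x : EuclideanSpace ℝ (Fin m) => x i ^ k * Real.exp (-‖x‖ ^ 2) := by
    rw [← (PiLp.volume_preserving_toLp (Fin m)).integrable_comp_emb
      (MeasurableEquiv.toLp 2 _).measurableEmbedding]
    have : ((fun x : EuclideanSpace ℝ (Fin m) => x i ^ k * Real.exp (-‖x‖ ^ 2)) ∘ WithLp.toLp 2) =
        fun x : Fin m → ℝ => ∏ j, (x j ^ (if j = i then k else 0) * Real.exp (-(x j) ^ 2)) := by
      ext x; exact coord_pow_mul_exp_eq_prod i k x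
    rw [this]
    exact Integrable.fintype_prod
      (f := fun j (t : ℝ) => t ^ (if j = i then k else 0) * Real.exp (-t ^ 2))
      fun j => integrable_pow_mul_exp_neg_sq _
  have h2 := (e.measurePreserving.integrable_comp_emb
    e.toHomeomorph.measurableEmbedding).2 h1
  refine h2.congr (Filter.Eventually.of_forall fun x => ?_)
  simp [he x]

theorem integral_inner_pow_mul_gaussian (i : Fin m) (w : EuclideanSpace ℝ (Fin m))
    (hw : ‖w‖ = 1) (k : ℕ) :
    ∫ x : EuclideanSpace ℝ (Fin m), inner ℝ w x ^ (2 * k) * Real.exp (-‖x‖ ^ 2) =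
      Real.Gamma (k + 1 / 2) * √Real.pi ^ (m - 1) := by
  obtain ⟨e, he⟩ := exists_linearIsometryEquiv_inner i w hw
  have h2 := e.measurePreserving.integral_comp e.toHomeomorph.measurableEmbedding
    (fun x : EuclideanSpace ℝ (Fin m) => x i ^ (2 * k) * Real.exp (-‖x‖ ^ 2))
  simp only [e.norm_map, ← he] at h2
  rw [h2, ← (PiLp.volume_preserving_toLp (Fin m)).integral_comp
      (MeasurableEquiv.toLp 2 _).measurableEmbedding]
  rw [integral_congr_ae (Filter.Eventually.of_forall (coord_pow_mul_exp_eq_prod i (2 * k))),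
    integral_fintype_prod_volume_eq_prod
      (f := fun j (t : ℝ) => t ^ (if j = i then 2 * k else 0) * Real.exp (-t ^ 2))]
  rw [← Finset.mul_prod_erase _ _ (Finset.mem_univ i)]
  congr 1
  · simp only [if_true]; exact integral_even_pow_mul_exp_neg_sq k
  · rw [Finset.prod_congr rfl (g := fun _ => √Real.pi), Finset.prod_const]
    · simp
    · intro j hj
      have := integral_even_pow_mul_exp_neg_sq 0
      simp only [mul_zero, pow_zero, Nat.cast_zero, zero_add, Real.Gamma_one_half_eq] at this
      simp only [if_neg (Finset.ne_of_mem_erase hj), pow_zero]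
      exact this

/-- In polar coordinates the Gaussian moment splits into the sphere moment and the radial factor ∫
r^(j+m-1) exp(-r²) dr = Γ((j+m)/2)/2. As the Gaussian moment is also computable by Fubini, the
sphere moment follows. -/
theorem integral_inner_pow_sphere (i : Fin m) (w : EuclideanSpace ℝ (Fin m))
    (hw : ‖w‖ = 1) (j : ℕ) :
    (∫ x : EuclideanSpace ℝ (Fin m), inner ℝ w x ^ j * Real.exp (-‖x‖ ^ 2)) =
    (Real.Gamma ((j + m) / 2) / 2) *
      ∫ θ : sphere (0 : EuclideanSpace ℝ (Fin m)) 1, inner ℝ w (θ : EuclideanSpace ℝ (Fin m)) ^ j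
        ∂(volume : Measure (EuclideanSpace ℝ (Fin m))).toSphere := by
  have hm : 1 ≤ m := by have := i.2; omega
  rw [integral_eq_integral_Ioi_sphere hm _ (integrable_inner_pow_mul_gaussian i w hw j)]
  have h2 := integral_rpow_mul_exp_neg_rpow (p := 2) (q := (j + (m - 1) : ℕ)) (by norm_num)
    (by have : (0:ℝ) ≤ (j + (m - 1) : ℕ) := Nat.cast_nonneg _
        linarith)
  have h4 : (((j + (m - 1) : ℕ) : ℝ) + 1) / 2 = (j + m) / 2 := by
    push_cast [Nat.cast_sub hm]; ring
  rw [h4] at h2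
  rw [show Real.Gamma ((j + m) / 2) / 2 = 1 / 2 * Real.Gamma ((j + m) / 2) by ring, ← h2,
    ← integral_mul_const]
  refine setIntegral_congr_fun measurableSet_Ioi fun r hr => ?_
  have hr' : 0 < r := hr
  have : ∀ θ : sphere (0 : EuclideanSpace ℝ (Fin m)) 1,
      inner ℝ w (r • (θ : EuclideanSpace ℝ (Fin m))) ^ j *
        Real.exp (-‖r • (θ : EuclideanSpace ℝ (Fin m))‖ ^ 2) =
      (r ^ j * Real.exp (-r ^ 2)) * inner ℝ w (θ : EuclideanSpace ℝ (Fin m)) ^ j := by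
    intro θ
    rw [inner_smul_right, norm_smul, norm_eq_of_mem_sphere, mul_one, Real.norm_eq_abs, sq_abs,
      mul_pow]
    ring
  simp only [this]
  rw [integral_const_mul, Real.rpow_natCast, Real.rpow_ofNat, pow_add]
  ring

theorem integral_inner_odd_pow_sphere (i : Fin m) (w : EuclideanSpace ℝ (Fin m))
    (hw : ‖w‖ = 1) (j : ℕ) (hj : Odd j) :
    ∫ θ : sphere (0 : EuclideanSpace ℝ (Fin m)) 1, inner ℝ w (θ : EuclideanSpace ℝ (Fin m)) ^ j
        ∂(volume : Measure (EuclideanSpace ℝ (Fin m))).toSphere = 0 := by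
  have h := integral_inner_pow_sphere i w hw j
  have hm : 1 ≤ m := by have := i.2; omega
  have h0 := integral_neg_eq_self
    (fun x : EuclideanSpace ℝ (Fin m) => inner ℝ w x ^ j * Real.exp (-‖x‖ ^ 2)) volume
  simp only [inner_neg_right, hj.neg_pow, norm_neg, neg_mul, integral_neg] at h0
  have h1 : (∫ x : EuclideanSpace ℝ (Fin m), inner ℝ w x ^ j * Real.exp (-‖x‖ ^ 2)) = 0 := by
    linarith
  rw [h1] at h
  have hG : 0 < Real.Gamma ((j + m) / 2) := Real.Gamma_pos_of_pos (by positivity)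
  rcases mul_eq_zero.1 h.symm with h | h
  · linarith
  · exact h

theorem integral_inner_even_pow_sphere (i : Fin m) (w : EuclideanSpace ℝ (Fin m))
    (hw : ‖w‖ = 1) (k : ℕ) :
    ∫ θ : sphere (0 : EuclideanSpace ℝ (Fin m)) 1,
        inner ℝ w (θ : EuclideanSpace ℝ (Fin m)) ^ (2 * k)
        ∂(volume : Measure (EuclideanSpace ℝ (Fin m))).toSphere =
      2 * Real.Gamma (k + 1 / 2) * √Real.pi ^ (m - 1) / Real.Gamma (k + m / 2) := by
  have h := integral_inner_pow_sphere i w hw (2 * k)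
  have hm : 1 ≤ m := by have := i.2; omega
  rw [integral_inner_pow_mul_gaussian i w hw] at h
  have h4 : (((2 * k : ℕ) : ℝ) + m) / 2 = k + m / 2 := by push_cast; ring
  rw [h4] at h
  have hG : 0 < Real.Gamma (k + m / 2) := Real.Gamma_pos_of_pos (by positivity)
  rw [eq_div_iff hG.ne']
  linarith

end Gaussian

/-! ### Sphere and ball integrals of plane waves as Bessel functions -/

section SphereExp

variable {m : ℕ}

/-- The ball integral in polar coordinates around the centre. -/
theorem setIntegral_ball_eq_intervalIntegral_sphere (hm : 1 ≤ m)
    (v : EuclideanSpace ℝ (Fin m) → ℝ) (x : EuclideanSpace ℝ (Fin m)) {r : ℝ} (hr : 0 ≤ r)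
    (hv : ContinuousOn v (closedBall x r)) :
    ∫ y in ball x r, v y = ∫ ρ in (0 : ℝ)..r, ρ ^ (m - 1) *
      ∫ θ : sphere (0 : EuclideanSpace ℝ (Fin m)) 1, v (x + ρ • (θ : EuclideanSpace ℝ (Fin m)))
        ∂(volume : Measure (EuclideanSpace ℝ (Fin m))).toSphere := by
  have hint : IntegrableOn v (ball x r) :=
    (hv.integrableOn_compact (isCompact_closedBall x r)).mono_set ball_subset_closedBall
  have hind : Integrable ((ball x r).indicator v) :=
    (integrable_indicator_iff measurableSet_ball).2 hint
  rw [← integral_indicator measurableSet_ball,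
    ← integral_add_left_eq_self ((ball x r).indicator v) x,
    integral_eq_integral_Ioi_sphere hm _ (hind.comp_add_left x),
    intervalIntegral.integral_of_le hr, ← setIntegral_congr_set (Ioo_ae_eq_Ioc (a := (0:ℝ)) (b := r)),
    ← integral_indicator measurableSet_Ioi, ← integral_indicator measurableSet_Ioo]
  congr 1
  ext ρ
  by_cases hρ : 0 < ρ
  · rw [Set.indicator_of_mem (show ρ ∈ Set.Ioi (0:ℝ) from hρ)]
    have hn : ∀ θ : sphere (0 : EuclideanSpace ℝ (Fin m)) 1,
        dist (x + ρ • (θ : EuclideanSpace ℝ (Fin m))) x = ρ := by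
      intro θ
      rw [dist_eq_norm, add_sub_cancel_left, norm_smul, norm_eq_of_mem_sphere, mul_one,
        Real.norm_eq_abs, abs_of_pos hρ]
    by_cases h : ρ < r
    · rw [Set.indicator_of_mem (show ρ ∈ Set.Ioo (0:ℝ) r from ⟨hρ, h⟩)]
      congr 1
      refine integral_congr_ae (Filter.Eventually.of_forall fun θ => ?_)
      exact Set.indicator_of_mem (by rw [mem_ball, hn]; exact h) _
    · rw [Set.indicator_of_notMem (fun h' => h h'.2)]
      have : ∀ θ : sphere (0 : EuclideanSpace ℝ (Fin m)) 1,
          (ball x r).indicator v (x + ρ • (θ : EuclideanSpace ℝ (Fin m))) = 0 :=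
        fun θ => Set.indicator_of_notMem (by rw [mem_ball, hn]; exact h) _
      simp [this]
  · rw [Set.indicator_of_notMem (show ρ ∉ Set.Ioi (0:ℝ) from hρ),
      Set.indicator_of_notMem (fun h' => hρ h'.1)]

theorem abs_inner_sphere_le (w : EuclideanSpace ℝ (Fin m)) (hw : ‖w‖ = 1)
    (θ : sphere (0 : EuclideanSpace ℝ (Fin m)) 1) :
    |inner ℝ w (θ : EuclideanSpace ℝ (Fin m))| ≤ 1 := by
  have := abs_real_inner_le_norm w (θ : EuclideanSpace ℝ (Fin m))
  rwa [hw, norm_eq_of_mem_sphere, mul_one] at this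

/-- Legendre duplication at half-integers: it converts the exponential coefficient 1/(2k)! times the
moment factor Γ(k + 1/2) into the Bessel coefficient 1/(4^k k!), up to √π. -/
theorem factorial_two_mul_eq (k : ℕ) :
    ((2 * k).factorial : ℝ) * √Real.pi = 4 ^ k * k.factorial * Real.Gamma (k + 1 / 2) := by
  rcases k with _ | k
  · simpa using Real.Gamma_one_half_eq.symm
  rw [Real.Gamma_nat_add_half, show 2 * (k + 1) = (2 * k + 1) + 1 by ring,
    Nat.factorial_eq_mul_doubleFactorial, show 2 * k + 1 + 1 = 2 * (k + 1) by ring,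
    Nat.doubleFactorial_two_mul, show 2 * (k + 1) - 1 = 2 * k + 1 by omega]
  push_cast
  field_simp
  rw [show (4:ℝ) ^ (k + 1) = 2 ^ (2 * (k + 1)) by rw [pow_mul]; norm_num]
  ring

/-- Power series of the spherical integral of a plane wave. -/
theorem hasSum_integral_exp_inner_sphere (hm : 1 ≤ m) (w : EuclideanSpace ℝ (Fin m))
    (hw : ‖w‖ = 1) (t : ℝ) :
    HasSum (fun k : ℕ => 2 * √Real.pi ^ m * ((t / 2) ^ (2 * k) /
        (k.factorial * Real.Gamma (k + m / 2))))
      (∫ θ : sphere (0 : EuclideanSpace ℝ (Fin m)) 1,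
        Real.exp (t * inner ℝ w (θ : EuclideanSpace ℝ (Fin m)))
        ∂(volume : Measure (EuclideanSpace ℝ (Fin m))).toSphere) := by
  let i : Fin m := ⟨0, hm⟩
  have h1 : HasSum (fun j : ℕ => ∫ θ : sphere (0 : EuclideanSpace ℝ (Fin m)) 1,
        (t * inner ℝ w (θ : EuclideanSpace ℝ (Fin m))) ^ j / j.factorial
        ∂(volume : Measure (EuclideanSpace ℝ (Fin m))).toSphere)
      (∫ θ : sphere (0 : EuclideanSpace ℝ (Fin m)) 1,
        Real.exp (t * inner ℝ w (θ : EuclideanSpace ℝ (Fin m)))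
        ∂(volume : Measure (EuclideanSpace ℝ (Fin m))).toSphere) := by
    refine hasSum_integral_of_dominated_convergence (fun j _ => |t| ^ j / j.factorial)
      (fun j => ?_) (fun j => ?_) ?_ ?_ ?_
    · exact (by fun_prop : Continuous fun θ : sphere (0 : EuclideanSpace ℝ (Fin m)) 1 =>
        (t * inner ℝ w (θ : EuclideanSpace ℝ (Fin m))) ^ j / j.factorial).aestronglyMeasurable
    · refine Filter.Eventually.of_forall fun θ => ?_
      rw [norm_div, norm_pow, norm_mul, Real.norm_eq_abs, Real.norm_eq_abs, RCLike.norm_natCast]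
      gcongr
      exact mul_le_of_le_one_right (abs_nonneg _) (abs_inner_sphere_le w hw θ)
    · exact Filter.Eventually.of_forall fun θ => Real.summable_pow_div_factorial _
    · exact integrable_const _
    · refine Filter.Eventually.of_forall fun θ => ?_
      rw [Real.exp_eq_exp_ℝ]
      exact NormedSpace.expSeries_div_hasSum_exp _
  have h2 : ∀ j : ℕ, ∫ θ : sphere (0 : EuclideanSpace ℝ (Fin m)) 1,
        (t * inner ℝ w (θ : EuclideanSpace ℝ (Fin m))) ^ j / j.factorial
        ∂(volume : Measure (EuclideanSpace ℝ (Fin m))).toSphere = t ^ j / j.factorial *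
      ∫ θ : sphere (0 : EuclideanSpace ℝ (Fin m)) 1, inner ℝ w (θ : EuclideanSpace ℝ (Fin m)) ^ j
        ∂(volume : Measure (EuclideanSpace ℝ (Fin m))).toSphere := by
    intro j
    rw [← integral_const_mul]
    congr 1
    ext θ
    rw [mul_pow]
    ring
  -- Odd moments vanish, so the series may be reindexed over even exponents.
  have hinj : Function.Injective (fun k : ℕ => 2 * k) := fun a b h => by simpa using h
  rw [← hinj.hasSum_iff] at h1
  · refine h1.congr_fun fun k => ?_
    simp only [Function.comp_apply]
    rw [h2, integral_inner_even_pow_sphere i w hw]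
    have hf := factorial_two_mul_eq k
    have hpi : √Real.pi ≠ 0 := by positivity
    have hG : Real.Gamma (k + m / 2) ≠ 0 := (Real.Gamma_pos_of_pos (by positivity)).ne'
    have hfac : ((2 * k).factorial : ℝ) = 4 ^ k * k.factorial * Real.Gamma (k + 1 / 2) / √Real.pi := by
      rw [eq_div_iff hpi, hf]
    have hG2 : Real.Gamma (k + 1 / 2) ≠ 0 := (Real.Gamma_pos_of_pos (by positivity)).ne'
    rw [hfac, ← Nat.sub_add_cancel hm, pow_succ (√Real.pi), Nat.sub_add_cancel hm, div_pow,
      pow_mul 2, show (2:ℝ) ^ 2 = 4 by norm_num]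
    field_simp
  · intro j hj
    have hodd : Odd j := by
      by_contra h
      rw [Nat.not_odd_iff_even] at h
      obtain ⟨k, hk⟩ := h
      exact hj ⟨k, by simp only; omega⟩
    rw [h2, integral_inner_odd_pow_sphere i w hw j hodd, mul_zero]

/-- Power series of the integral of a plane wave over a ball. -/
theorem hasSum_integral_exp_inner_ball (hm : 1 ≤ m) (w : EuclideanSpace ℝ (Fin m))
    (hw : ‖w‖ = 1) (μ : ℝ) {r : ℝ} (hr : 0 ≤ r) :
    HasSum (fun k : ℕ => √Real.pi ^ m * r ^ m * ((μ * r / 2) ^ (2 * k) /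
        (k.factorial * Real.Gamma (k + m / 2 + 1))))
      (∫ y in ball (0 : EuclideanSpace ℝ (Fin m)) r, Real.exp (μ * inner ℝ w y)) := by
  rw [setIntegral_ball_eq_intervalIntegral_sphere hm _ _ hr
    (by fun_prop : Continuous fun y : EuclideanSpace ℝ (Fin m) =>
      Real.exp (μ * inner ℝ w y)).continuousOn]
  simp only [zero_add, inner_smul_right]
  have h1 : ∀ ρ : ℝ, HasSum (fun k : ℕ => ρ ^ (m - 1) * (2 * √Real.pi ^ m *
      ((μ * ρ / 2) ^ (2 * k) / (k.factorial * Real.Gamma (k + m / 2)))))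
      (ρ ^ (m - 1) * ∫ θ : sphere (0 : EuclideanSpace ℝ (Fin m)) 1,
        Real.exp (μ * (ρ * inner ℝ w (θ : EuclideanSpace ℝ (Fin m))))
        ∂(volume : Measure (EuclideanSpace ℝ (Fin m))).toSphere) := by
    intro ρ
    have := (hasSum_integral_exp_inner_sphere hm w hw (μ * ρ)).mul_left (ρ ^ (m - 1))
    simpa only [mul_assoc] using this
  have h2 := intervalIntegral.hasSum_integral_of_dominated_convergence (a := 0) (b := r)
    (μ := volume)
    (F := fun (k : ℕ) (ρ : ℝ) => ρ ^ (m - 1) * (2 * √Real.pi ^ m *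
      ((μ * ρ / 2) ^ (2 * k) / (k.factorial * Real.Gamma (k + m / 2)))))
    (f := fun ρ => ρ ^ (m - 1) * ∫ θ : sphere (0 : EuclideanSpace ℝ (Fin m)) 1,
        Real.exp (μ * (ρ * inner ℝ w (θ : EuclideanSpace ℝ (Fin m))))
        ∂(volume : Measure (EuclideanSpace ℝ (Fin m))).toSphere)
    -- Every term is nonnegative and nondecreasing in ρ on (0, r], so its value at ρ = r dominates;
    -- summability of the bounds is the series at r.
    (fun k _ => r ^ (m - 1) * (2 * √Real.pi ^ m *
      ((μ * r / 2) ^ (2 * k) / (k.factorial * Real.Gamma (k + m / 2)))))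
    (fun k => (by fun_prop : Continuous fun ρ : ℝ => ρ ^ (m - 1) * (2 * √Real.pi ^ m *
      ((μ * ρ / 2) ^ (2 * k) / (k.factorial * Real.Gamma (k + m / 2))))).aestronglyMeasurable)
    (fun k => Filter.Eventually.of_forall fun ρ hρ => by
      rw [Set.uIoc_of_le hr] at hρ
      have hρ0 := hρ.1.le
      have hG : 0 < Real.Gamma (k + m / 2) := Real.Gamma_pos_of_pos (by positivity)
      have e : ∀ s : ℝ, (μ * s / 2) ^ (2 * k) = ((μ / 2) ^ 2) ^ k * s ^ (2 * k) := fun s => by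
        rw [show μ * s / 2 = μ / 2 * s by ring, mul_pow, pow_mul (μ / 2)]
      rw [e, e, Real.norm_of_nonneg (by positivity)]
      gcongr
      · exact hρ.2
      · exact hρ.2)
    (Filter.Eventually.of_forall fun ρ _ => (h1 r).summable)
    (by simp)
    (Filter.Eventually.of_forall fun ρ _ => h1 ρ)
  refine h2.congr_fun fun k => ?_
  have hG : Real.Gamma (k + m / 2) ≠ 0 := (Real.Gamma_pos_of_pos (by positivity)).ne'
  have hkm : (k + m / 2 : ℝ) ≠ 0 := by positivity
  have h3 : ∀ ρ : ℝ, ρ ^ (m - 1) * (2 * √Real.pi ^ m *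
      ((μ * ρ / 2) ^ (2 * k) / (k.factorial * Real.Gamma (k + m / 2)))) =
      (2 * √Real.pi ^ m * (μ / 2) ^ (2 * k) / (k.factorial * Real.Gamma (k + m / 2))) *
        ρ ^ (2 * k + m - 1) := by
    intro ρ
    rw [show 2 * k + m - 1 = (m - 1) + 2 * k by omega, pow_add,
      show μ * ρ / 2 = μ / 2 * ρ by ring, mul_pow]
    ring
  simp only [h3]
  rw [intervalIntegral.integral_const_mul, integral_pow, show 2 * k + m - 1 + 1 = m + 2 * k by omega,
    Real.Gamma_add_one hkm, zero_pow (by omega), pow_add, show μ * r / 2 = μ / 2 * r by ring, mul_pow]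
  have : (((2 * k + m - 1 : ℕ) : ℝ) + 1) = 2 * (k + m / 2) := by
    rw [Nat.cast_sub (by omega)]
    push_cast; ring
  rw [this]
  field_simp
  ring

theorem volume_real_ball_eq (hm : 1 ≤ m) (x : EuclideanSpace ℝ (Fin m)) {r : ℝ} (hr : 0 ≤ r) :
    volume.real (ball x r) = √Real.pi ^ m * r ^ m / Real.Gamma (m / 2 + 1) := by
  have : Nonempty (Fin m) := ⟨⟨0, hm⟩⟩
  have hG : 0 < Real.Gamma (m / 2 + 1 : ℝ) := Real.Gamma_pos_of_pos (by positivity)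
  rw [measureReal_def, EuclideanSpace.volume_ball]
  simp only [Fintype.card_fin]
  rw [ENNReal.toReal_mul, ENNReal.toReal_pow, ENNReal.toReal_ofReal hr,
    ENNReal.toReal_ofReal (by positivity)]
  ring

/-- The average of a plane wave over a ball exceeds its value at the centre. -/
theorem volume_ball_lt_integral_exp_inner_ball (hm : 1 ≤ m) (w : EuclideanSpace ℝ (Fin m))
    (hw : ‖w‖ = 1) {μ : ℝ} (hμ : 0 < μ) (x : EuclideanSpace ℝ (Fin m)) {r : ℝ} (hr : 0 < r) :
    volume.real (ball x r) <
      ∫ y in ball (0 : EuclideanSpace ℝ (Fin m)) r, Real.exp (μ * inner ℝ w y) := by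
  have h := hasSum_integral_exp_inner_ball hm w hw μ hr.le
  have hpos : ∀ k : ℕ, 0 < √Real.pi ^ m * r ^ m * ((μ * r / 2) ^ (2 * k) /
        (k.factorial * Real.Gamma (k + m / 2 + 1))) := fun k => by
    have hG : 0 < Real.Gamma (k + m / 2 + 1) := Real.Gamma_pos_of_pos (by positivity)
    positivity
  -- The term k = 0 is the volume of the ball; the positive term k = 1 makes the inequality strict.
  have h2 := sum_le_hasSum (Finset.range 2) (fun k _ => (hpos k).le) h
  rw [Finset.sum_range_succ, Finset.sum_range_one] at h2
  have h1 := hpos 1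
  rw [volume_real_ball_eq hm x hr.le]
  have : √Real.pi ^ m * r ^ m * ((μ * r / 2) ^ (2 * 0) /
        ((0:ℕ).factorial * Real.Gamma ((0:ℕ) + m / 2 + 1))) =
        √Real.pi ^ m * r ^ m / Real.Gamma (m / 2 + 1) := by
    simp [div_eq_mul_inv]
  linarith

theorem integral_exp_inner_sphere_eq_besselI (hm : 1 ≤ m) (w : EuclideanSpace ℝ (Fin m))
    (hw : ‖w‖ = 1) {t : ℝ} (ht : 0 < t) :
    (t / 2) ^ (((m : ℝ) - 2) / 2) * (∫ θ : sphere (0 : EuclideanSpace ℝ (Fin m)) 1,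
        Real.exp (t * inner ℝ w (θ : EuclideanSpace ℝ (Fin m)))
        ∂(volume : Measure (EuclideanSpace ℝ (Fin m))).toSphere) =
      2 * √Real.pi ^ m * besselI (((m : ℝ) - 2) / 2) t := by
  have h := (hasSum_integral_exp_inner_sphere hm w hw t).mul_left ((t / 2) ^ (((m : ℝ) - 2) / 2))
  rw [← h.tsum_eq, besselI, ← tsum_mul_left]
  congr 1
  ext k
  rw [show (k : ℝ) + (m - 2) / 2 + 1 = k + m / 2 by ring, Real.rpow_add (by positivity),
    show 2 * (k : ℝ) = ((2 * k : ℕ) : ℝ) by push_cast; ring, Real.rpow_natCast]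
  ring

theorem integral_exp_inner_ball_eq_besselI (hm : 1 ≤ m) (w : EuclideanSpace ℝ (Fin m))
    (hw : ‖w‖ = 1) {μ : ℝ} (hμ : 0 < μ) {r : ℝ} (hr : 0 < r) :
    (μ * r / 2) ^ ((m : ℝ) / 2) *
      (∫ y in ball (0 : EuclideanSpace ℝ (Fin m)) r, Real.exp (μ * inner ℝ w y)) =
      √Real.pi ^ m * r ^ m * besselI ((m : ℝ) / 2) (μ * r) := by
  have h := (hasSum_integral_exp_inner_ball hm w hw μ hr.le).mul_left ((μ * r / 2) ^ ((m : ℝ) / 2))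
  rw [← h.tsum_eq, besselI, ← tsum_mul_left]
  congr 1
  ext k
  rw [Real.rpow_add (by positivity),
    show 2 * (k : ℝ) = ((2 * k : ℕ) : ℝ) by push_cast; ring, Real.rpow_natCast]
  ring

end SphereExp

/-! ### From the relation between means to a ball mean property -/

section MeanRelation

variable {m : ℕ}

theorem continuous_integral_sphere (v : EuclideanSpace ℝ (Fin m) → ℝ) (hv : Continuous v)
    (x : EuclideanSpace ℝ (Fin m)) :
    Continuous fun ρ : ℝ => ∫ θ : sphere (0 : EuclideanSpace ℝ (Fin m)) 1,
      v (x + ρ • (θ : EuclideanSpace ℝ (Fin m)))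
        ∂(volume : Measure (EuclideanSpace ℝ (Fin m))).toSphere := by
  have := continuous_parametric_integral_of_continuous
    (μ := (volume : Measure (EuclideanSpace ℝ (Fin m))).toSphere)
    (f := fun (ρ : ℝ) (θ : sphere (0 : EuclideanSpace ℝ (Fin m)) 1) =>
      v (x + ρ • (θ : EuclideanSpace ℝ (Fin m)))) (by
        simp only [Function.uncurry_def]
        fun_prop) (isCompact_univ)
  simpa only [Measure.restrict_univ] using this

/-- In polar coordinates the ball integral is a primitive of a continuous function of the radius. -/
theorem hasDerivAt_integral_ball (hm : 1 ≤ m) (v : EuclideanSpace ℝ (Fin m) → ℝ)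
    (hv : Continuous v) (x : EuclideanSpace ℝ (Fin m)) {r : ℝ} (hr : 0 < r) :
    HasDerivAt (fun r => ∫ y in ball x r, v y)
      (r ^ (m - 1) * ∫ θ : sphere (0 : EuclideanSpace ℝ (Fin m)) 1,
        v (x + r • (θ : EuclideanSpace ℝ (Fin m)))
          ∂(volume : Measure (EuclideanSpace ℝ (Fin m))).toSphere) r := by
  have hc := (continuous_pow (M := ℝ) (m - 1)).mul (continuous_integral_sphere v hv x)
  refine (hc.integral_hasStrictDerivAt 0 r).hasDerivAt.congr_of_eventuallyEq ?_
  filter_upwards [lt_mem_nhds hr] with ρ hρ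
  exact setIntegral_ball_eq_intervalIntegral_sphere hm v x hρ.le hv.continuousOn

/-- The relation between spherical and ball means, with the Bessel functions replaced by the
spherical and ball integrals of a plane wave. -/
theorem integral_ball_mul_integral_sphere_of_mean_relation (hm : 1 ≤ m)
    (w : EuclideanSpace ℝ (Fin m)) (hw : ‖w‖ = 1) {μ : ℝ} (hμ : 0 < μ)
    (v : EuclideanSpace ℝ (Fin m) → ℝ) (x : EuclideanSpace ℝ (Fin m)) {r : ℝ} (hr : 0 < r)
    (h : (m : ℝ) * besselI ((m : ℝ) / 2) (μ * r) * sphereMean v x r =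
        μ * r * besselI (((m : ℝ) - 2) / 2) (μ * r) * ballMean v x r) :
    (∫ y in ball (0 : EuclideanSpace ℝ (Fin m)) r, Real.exp (μ * inner ℝ w y)) *
      (∫ θ : sphere (0 : EuclideanSpace ℝ (Fin m)) 1, v (x + r • (θ : EuclideanSpace ℝ (Fin m)))
        ∂(volume : Measure (EuclideanSpace ℝ (Fin m))).toSphere) =
    (∫ θ : sphere (0 : EuclideanSpace ℝ (Fin m)) 1,
        Real.exp (μ * r * inner ℝ w (θ : EuclideanSpace ℝ (Fin m)))
        ∂(volume : Measure (EuclideanSpace ℝ (Fin m))).toSphere) * ∫ y in ball x r, v y := by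
  have hmpos : (0 : ℝ) < m := by exact_mod_cast hm
  have hE := integral_exp_inner_sphere_eq_besselI hm w hw (mul_pos hμ hr)
  have hQ := integral_exp_inner_ball_eq_besselI hm w hw hμ hr
  rw [sphereMean, ballMean, sphereIntegral, sphereArea, volume_real_ball_eq hm x hr.le,
    Real.Gamma_add_one (by positivity)] at h
  have hpi : Real.pi ^ ((m : ℝ) / 2) = √Real.pi ^ m := by
    rw [Real.sqrt_eq_rpow, ← Real.rpow_natCast, ← Real.rpow_mul Real.pi_pos.le]
    congr 1; ring
  rw [hpi] at h
  have hz : 0 < μ * r / 2 := by positivity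
  -- The two Bessel orders differ by one, so a single power Z of μr/2 can be cancelled at the end.
  have hrp : (μ * r / 2) ^ ((m : ℝ) / 2) = (μ * r / 2) ^ (((m : ℝ) - 2) / 2) * (μ * r / 2) := by
    rw [← Real.rpow_add_one hz.ne']
    congr 1; ring
  rw [hrp] at hQ
  have hzp : 0 < (μ * r / 2) ^ (((m : ℝ) - 2) / 2) := Real.rpow_pos_of_pos hz _
  have hG : 0 < Real.Gamma ((m : ℝ) / 2) := Real.Gamma_pos_of_pos (by positivity)
  have hs : 0 < √Real.pi ^ m := by positivity
  have hrm : 0 < r ^ m := by positivity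
  have hrm1 : 0 < r ^ (m - 1) := by positivity
  generalize (∫ y in ball (0 : EuclideanSpace ℝ (Fin m)) r, Real.exp (μ * inner ℝ w y)) = Q at *
  generalize (∫ θ : sphere (0 : EuclideanSpace ℝ (Fin m)) 1,
    v (x + r • (θ : EuclideanSpace ℝ (Fin m)))
        ∂(volume : Measure (EuclideanSpace ℝ (Fin m))).toSphere) = s at *
  generalize (∫ θ : sphere (0 : EuclideanSpace ℝ (Fin m)) 1,
        Real.exp (μ * r * inner ℝ w (θ : EuclideanSpace ℝ (Fin m)))
        ∂(volume : Measure (EuclideanSpace ℝ (Fin m))).toSphere) = e at *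
  generalize (∫ y in ball x r, v y) = P at *
  generalize besselI ((m : ℝ) / 2) (μ * r) = A at *
  generalize besselI (((m : ℝ) - 2) / 2) (μ * r) = B at *
  generalize (μ * r / 2) ^ (((m : ℝ) - 2) / 2) = Z at *
  generalize √Real.pi ^ m = S at *
  generalize Real.Gamma ((m : ℝ) / 2) = G at *
  generalize r ^ m = T at *
  generalize r ^ (m - 1) = T1 at *
  -- The dimensional constants cancel because Γ(m/2 + 1) = (m/2) Γ(m/2).
  have h1 : A * s * T = μ * r * B * P := by
    field_simp at h
    linarith
  have h2 : (Z * μ * r) * (Q * s) = (Z * μ * r) * (e * P) := by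
    linear_combination (2 * s) * hQ + 2 * S * h1 - μ * r * P * hE
  exact mul_left_cancel₀ (by positivity) h2

/-- With P, Q the ball integrals of v and of the plane wave, and s, e their integrals over the unit
sphere, P' = r^(m-1) s and Q' = r^(m-1) e. The relation Q s = e P therefore says (P/Q)' = 0. -/
theorem setIntegral_ball_eq_of_continuous (hm : 1 ≤ m)
    (w : EuclideanSpace ℝ (Fin m)) (hw : ‖w‖ = 1) {μ : ℝ} (hμ : 0 < μ)
    (v : EuclideanSpace ℝ (Fin m) → ℝ) (hv : Continuous v) (x : EuclideanSpace ℝ (Fin m)) {R : ℝ}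
    (h : ∀ r ∈ Set.Ioo 0 R, (m : ℝ) * besselI ((m : ℝ) / 2) (μ * r) * sphereMean v x r =
        μ * r * besselI (((m : ℝ) - 2) / 2) (μ * r) * ballMean v x r) :
    ∀ r ∈ Set.Ioo 0 R, ∫ y in ball x r, v y =
      v x * ∫ y in ball (0 : EuclideanSpace ℝ (Fin m)) r, Real.exp (μ * inner ℝ w y) := by
  set σ := (volume : Measure (EuclideanSpace ℝ (Fin m))).toSphere with hσ
  set s : ℝ → ℝ := fun r => ∫ θ : sphere (0 : EuclideanSpace ℝ (Fin m)) 1,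
    v (x + r • (θ : EuclideanSpace ℝ (Fin m))) ∂σ with hs
  have hwc : Continuous fun y : EuclideanSpace ℝ (Fin m) => Real.exp (μ * inner ℝ w y) := by
    fun_prop
  set e : ℝ → ℝ := fun r => ∫ θ : sphere (0 : EuclideanSpace ℝ (Fin m)) 1,
    Real.exp (μ * inner ℝ w (0 + r • (θ : EuclideanSpace ℝ (Fin m)))) ∂σ with he
  set P : ℝ → ℝ := fun r => ∫ y in ball x r, v y with hP
  set Q : ℝ → ℝ := fun r => ∫ y in ball (0 : EuclideanSpace ℝ (Fin m)) r,
    Real.exp (μ * inner ℝ w y) with hQ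
  have hsc : Continuous s := continuous_integral_sphere v hv x
  have hec : Continuous e := continuous_integral_sphere _ hwc 0
  have hPd : ∀ r, 0 < r → HasDerivAt P (r ^ (m - 1) * s r) r :=
    fun r hr => hasDerivAt_integral_ball hm v hv x hr
  have hQd : ∀ r, 0 < r → HasDerivAt Q (r ^ (m - 1) * e r) r :=
    fun r hr => hasDerivAt_integral_ball hm _ hwc 0 hr
  have hQpos : ∀ r, 0 < r → 0 < Q r := fun r hr =>
    measureReal_nonneg.trans_lt (volume_ball_lt_integral_exp_inner_ball hm w hw hμ 0 hr)
  have hrel : ∀ r ∈ Set.Ioo 0 R, Q r * s r = e r * P r := by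
    intro r hr
    have := integral_ball_mul_integral_sphere_of_mean_relation hm w hw hμ v x hr.1 (h r hr)
    simpa only [he, zero_add, inner_smul_right, mul_assoc] using this
  rcases le_or_gt R 0 with hR | hR
  · intro r hr
    exact absurd (hr.1.trans hr.2) (not_lt.2 hR)
  have hd : ∀ r ∈ Set.Ioo 0 R, HasDerivAt (fun r => P r / Q r) 0 r := by
    intro r hr
    convert! (hPd r hr.1).div (hQd r hr.1) (hQpos r hr.1).ne' using 1
    rw [eq_comm, div_eq_zero_iff]
    left
    linear_combination r ^ (m - 1) * hrel r hr
  obtain ⟨c, hc⟩ := isOpen_Ioo.exists_is_const_of_deriv_eq_zero isPreconnected_Ioo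
    (fun r hr => (hd r hr).differentiableAt.differentiableWithinAt)
    (fun r hr => (hd r hr).deriv)
  have hPc : ∀ r ∈ Set.Ioo 0 R, P r = c * Q r := by
    intro r hr
    have := hc r hr
    rwa [div_eq_iff (hQpos r hr.1).ne'] at this
  have hsc' : Set.EqOn s (fun r => c * e r) (Set.Ioo 0 R) := by
    intro r hr
    have h1 := hrel r hr
    rw [hPc r hr] at h1
    exact mul_left_cancel₀ (hQpos r hr.1).ne' (by linear_combination h1)
  -- The constant c is found at r = 0: by continuity s = c e persists there, where s is v x times
  -- the area of the unit sphere and e is that area.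
  have h0 := hsc'.closure hsc (hec.const_mul c) (x := 0) (by
    rw [closure_Ioo hR.ne]
    exact ⟨le_rfl, hR.le⟩)
  have hσpos : 0 < σ.real Set.univ := by
    rw [hσ, Measure.toSphere_real_apply_univ]
    have h1 : 0 < (volume : Measure (EuclideanSpace ℝ (Fin m))).real (ball 0 1) := by
      rw [measureReal_def]
      exact ENNReal.toReal_pos (measure_ball_pos _ _ one_pos).ne' measure_ball_lt_top.ne
    have h2 : (0 : ℝ) < m := by exact_mod_cast hm
    rw [finrank_euclideanSpace_fin]
    positivity
  simp only [hs, he, zero_smul, add_zero, inner_zero_right, mul_zero, Real.exp_zero,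
    integral_const, smul_eq_mul, mul_one] at h0
  have hcv : c = v x := mul_left_cancel₀ hσpos.ne' (by linarith)
  intro r hr
  rw [← hcv]
  exact hPc r hr

/-- A continuous function satisfying the relation between spherical and ball means has the
ball-mean property of plane waves. -/
theorem setIntegral_ball_eq_of_mean_relation (hm : 1 ≤ m)
    (w : EuclideanSpace ℝ (Fin m)) (hw : ‖w‖ = 1) {μ : ℝ} (hμ : 0 < μ)
    (v : EuclideanSpace ℝ (Fin m) → ℝ) (x : EuclideanSpace ℝ (Fin m)) {R : ℝ}
    (hv : ContinuousOn v (closedBall x R))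
    (h : ∀ r ∈ Set.Ioo 0 R, (m : ℝ) * besselI ((m : ℝ) / 2) (μ * r) * sphereMean v x r =
        μ * r * besselI (((m : ℝ) - 2) / 2) (μ * r) * ballMean v x r) :
    ∀ r ∈ Set.Ioo 0 R, ∫ y in ball x r, v y =
      v x * ∫ y in ball (0 : EuclideanSpace ℝ (Fin m)) r, Real.exp (μ * inner ℝ w y) := by
  -- Tietze extension to a globally continuous g; the means for r < R see only the closed ball,
  -- where g = v.
  obtain ⟨g, hg⟩ := ContinuousMap.exists_restrict_eq (isClosed_closedBall (x := x) (ε := R))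
    ⟨(closedBall x R).domRestrict v, hv.domRestrict⟩
  have hgv : ∀ y ∈ closedBall x R, g y = v y := fun y hy => DFunLike.congr_fun hg ⟨y, hy⟩
  have hball : ∀ r ∈ Set.Ioo 0 R, ∫ y in ball x r, g y = ∫ y in ball x r, v y := fun r hr =>
    setIntegral_congr_fun measurableSet_ball fun y hy =>
      hgv y (closedBall_subset_closedBall hr.2.le (ball_subset_closedBall hy))
  have hsph : ∀ r ∈ Set.Ioo 0 R, sphereMean g x r = sphereMean v x r := by
    intro r hr
    rw [sphereMean, sphereMean, sphereIntegral, sphereIntegral]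
    congr 3
    ext θ
    refine hgv _ ?_
    rw [mem_closedBall, dist_eq_norm, add_sub_cancel_left, norm_smul, norm_eq_of_mem_sphere,
      mul_one, Real.norm_eq_abs, abs_of_pos hr.1]
    exact hr.2.le
  intro r hr
  have := setIntegral_ball_eq_of_continuous hm w hw hμ g g.continuous x (R := R)
    (fun r hr => by
      rw [hsph r hr, ballMean, hball r hr]
      exact h r hr) r hr
  rwa [hball r hr, hgv x (mem_closedBall_self (hr.1.trans hr.2).le)] at this

end MeanRelation

/-! ### Second derivative test and separating functionals -/

/-- A positive second derivative would make a also a local minimum, so f would be constant near a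
and its second derivative zero. -/
theorem IsLocalMax.second_deriv_nonpos {f f' : ℝ → ℝ} {a f'' : ℝ} (h : IsLocalMax f a)
    (hf : ∀ᶠ t in nhds a, HasDerivAt f (f' t) t) (hf' : HasDerivAt f' f'' a) : f'' ≤ 0 := by
  by_contra! hpos
  have hd : deriv f =ᶠ[nhds a] f' := hf.mono fun t ht => ht.deriv
  have hdd : deriv (deriv f) a = f'' := by rw [hd.deriv_eq, hf'.deriv]
  have hmin : IsLocalMin f a := isLocalMin_of_deriv_deriv_pos (by rwa [hdd]) h.deriv_eq_zero
    hf.self_of_nhds.continuousAt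
  have hconst : f =ᶠ[nhds a] fun _ => f a := by
    filter_upwards [h, hmin] with t h1 h2 using le_antisymm h1 h2
  have h0 : deriv f =ᶠ[nhds a] fun _ => 0 := by
    refine hconst.deriv.trans ?_
    simp
  have : deriv (deriv f) a = 0 := by rw [h0.deriv_eq]; simp
  linarith

/-- Hahn–Banach separation; a functional bounded above on a subspace vanishes on it. -/
theorem Submodule.exists_strongDual_of_notMem_topologicalClosure {F : Type*}
    [NormedAddCommGroup F] [NormedSpace ℝ F] (T : Submodule ℝ F) {f : F}
    (hf : f ∉ T.topologicalClosure) :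
    ∃ Λ : StrongDual ℝ F, (∀ g ∈ T, Λ g = 0) ∧ Λ f ≠ 0 := by
  obtain ⟨Λ, u, h1, h2⟩ := geometric_hahn_banach_closed_point
    T.topologicalClosure.convex T.isClosed_topologicalClosure hf
  have hz : ∀ g ∈ T, Λ g = 0 := by
    intro g hg
    by_contra hne
    have := h1 ((u / Λ g) • g) (T.le_topologicalClosure (T.smul_mem _ hg))
    rw [map_smul, smul_eq_mul, div_mul_cancel₀ _ hne] at this
    exact lt_irrefl _ this
  refine ⟨Λ, hz, ?_⟩
  have := h1 0 (Submodule.zero_mem _)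
  rw [map_zero] at this
  linarith

/-! ### Density of plane waves in the continuous functions on a sphere -/

section Density

variable {E : Type*} [NormedAddCommGroup E] [InnerProductSpace ℝ E] [FiniteDimensional ℝ E]

/-- The linear functions `x ↦ ⟪ξ, x - x₀⟫`, restricted to a sphere around `x₀`. -/
def sphereLinear (x₀ : E) (ρ : ℝ) : E →L[ℝ] C(sphere x₀ ρ, ℝ) :=
  LinearMap.toContinuousLinearMap
    { toFun := fun ξ => ⟨fun x => inner ℝ ξ ((x : E) - x₀), by fun_prop⟩
      map_add' := fun ξ η => by ext x; simp [inner_add_left]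
      map_smul' := fun c ξ => by ext x; simp [inner_smul_left] }

theorem sphereLinear_apply (x₀ : E) (ρ : ℝ) (ξ : E) (x : sphere x₀ ρ) :
    sphereLinear x₀ ρ ξ x = inner ℝ ξ ((x : E) - x₀) := rfl

/-- The exponential functions `x ↦ exp ⟪ξ, x - x₀⟫`, restricted to a sphere around `x₀`. -/
def sphereExp (x₀ : E) (ρ : ℝ) (ξ : E) : C(sphere x₀ ρ, ℝ) :=
  -- Exponentiating in the Banach algebra C(sphere), not pointwise, gives continuity, derivatives
  -- and analyticity in ξ for the sup norm, so they survive applying a functional.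
  NormedSpace.exp (sphereLinear x₀ ρ ξ)

theorem sphereExp_apply (x₀ : E) (ρ : ℝ) (ξ : E) (x : sphere x₀ ρ) :
    sphereExp x₀ ρ ξ x = Real.exp (inner ℝ ξ ((x : E) - x₀)) := by
  rw [sphereExp, Real.exp_eq_exp_ℝ, ← sphereLinear_apply]
  exact NormedSpace.map_exp (ContinuousMap.evalAlgHom ℝ ℝ x : C(sphere x₀ ρ, ℝ) →ₐ[ℝ] ℝ)
    (continuous_eval_const x) _

theorem sphereExp_add (x₀ : E) (ρ : ℝ) (ξ η : E) :
    sphereExp x₀ ρ (ξ + η) = sphereExp x₀ ρ ξ * sphereExp x₀ ρ η := by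
  ext x
  simp [sphereExp_apply, inner_add_left, Real.exp_add]

theorem continuous_sphereExp (x₀ : E) (ρ : ℝ) : Continuous (sphereExp x₀ ρ) :=
  NormedSpace.exp_continuous.comp (sphereLinear x₀ ρ).continuous

theorem hasDerivAt_sphereExp (x₀ : E) (ρ : ℝ) (ξ e : E) (t : ℝ) :
    HasDerivAt (fun t : ℝ => sphereExp x₀ ρ (ξ + t • e))
      (sphereExp x₀ ρ (ξ + t • e) * sphereLinear x₀ ρ e) t := by
  have h := (hasDerivAt_exp_smul_const (𝕂 := ℝ) (sphereLinear x₀ ρ e) t).const_mul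
    (sphereExp x₀ ρ ξ)
  simp only [← map_smul] at h
  simp only [sphereExp_add]
  rw [mul_assoc]
  exact h

/-- Since |x - x₀| = ρ on the sphere, the Laplacian in ξ of exp⟨ξ, x - x₀⟩ is ρ² times the function
itself. -/
theorem sum_sphereLinear_sq (x₀ : E) (ρ : ℝ) :
    ∑ i, sphereLinear x₀ ρ (stdOrthonormalBasis ℝ E i) * sphereLinear x₀ ρ (stdOrthonormalBasis ℝ E i)
      = (ρ ^ 2) • (1 : C(sphere x₀ ρ, ℝ)) := by
  ext x
  have h := (stdOrthonormalBasis ℝ E).sum_sq_inner_right ((x : E) - x₀)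
  have hx : ‖(x : E) - x₀‖ = ρ := by rw [← dist_eq_norm]; exact x.2
  rw [hx] at h
  simp only [ContinuousMap.coe_sum, Finset.sum_apply, ContinuousMap.mul_apply, sphereLinear_apply,
    ContinuousMap.smul_apply, ContinuousMap.one_apply, smul_eq_mul, mul_one]
  rw [← h]
  exact Finset.sum_congr rfl fun i _ => (sq _).symm

/-- Maximum principle for the transform `ξ ↦ Λ (sphereExp ξ)`, which solves the modified Helmholtz
equation with constant `ρ`. -/
theorem strongDual_sphereExp_nonpos (x₀ : E) {ρ : ℝ} (hρ : 0 < ρ)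
    (Λ : StrongDual ℝ C(sphere x₀ ρ, ℝ)) {μ : ℝ}
    (h : ∀ ξ : E, ‖ξ‖ = μ → Λ (sphereExp x₀ ρ ξ) = 0) (ξ : E) (hξ : ‖ξ‖ ≤ μ) :
    Λ (sphereExp x₀ ρ ξ) ≤ 0 := by
  by_contra! hpos
  have hc : Continuous fun ξ => Λ (sphereExp x₀ ρ ξ) :=
    Λ.continuous.comp (continuous_sphereExp x₀ ρ)
  obtain ⟨η, hη, hmax⟩ := (isCompact_closedBall (0 : E) μ).exists_isMaxOn
    ⟨ξ, by simpa using hξ⟩ hc.continuousOn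
  have hηpos : 0 < Λ (sphereExp x₀ ρ η) :=
    hpos.trans_le (hmax (by simpa using hξ : ξ ∈ closedBall (0 : E) μ))
  have hηlt : ‖η‖ < μ := by
    refine lt_of_le_of_ne (by simpa using hη) fun heq => ?_
    rw [h η heq] at hηpos
    exact lt_irrefl _ hηpos
  have hloc : IsLocalMax (fun ξ => Λ (sphereExp x₀ ρ ξ)) η :=
    hmax.isLocalMax (Filter.mem_of_superset (isOpen_ball.mem_nhds (by simpa using hηlt))
      ball_subset_closedBall)
  -- The left side is the second derivative of the transform at its interior maximum η in direction
  -- e. Summed over a basis it equals ρ² times a positive value, a contradiction.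
  have hsec : ∀ e : E, Λ (sphereExp x₀ ρ η * (sphereLinear x₀ ρ e * sphereLinear x₀ ρ e)) ≤ 0 := by
    intro e
    have hline : Continuous fun t : ℝ => η + t • e := by fun_prop
    have h1 : IsLocalMax (fun t : ℝ => Λ (sphereExp x₀ ρ (η + t • e))) 0 := by
      have hl : Filter.Tendsto (fun t : ℝ => η + t • e) (nhds 0) (nhds η) := by
        simpa using hline.tendsto 0
      have := hl.eventually hloc
      simpa [IsLocalMax, IsMaxFilter] using this
    refine h1.second_deriv_nonpos
      (f' := fun t => Λ (sphereExp x₀ ρ (η + t • e) * sphereLinear x₀ ρ e))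
      (Filter.Eventually.of_forall fun t =>
        Λ.hasFDerivAt.comp_hasDerivAt t (hasDerivAt_sphereExp x₀ ρ η e t)) ?_
    have h2 := Λ.hasFDerivAt.comp_hasDerivAt (0 : ℝ)
      ((hasDerivAt_sphereExp x₀ ρ η e 0).mul_const (sphereLinear x₀ ρ e))
    simpa [mul_assoc] using! h2
  have hsum : ∑ i, Λ (sphereExp x₀ ρ η * (sphereLinear x₀ ρ (stdOrthonormalBasis ℝ E i) *
      sphereLinear x₀ ρ (stdOrthonormalBasis ℝ E i))) = ρ ^ 2 * Λ (sphereExp x₀ ρ η) := by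
    rw [← map_sum, ← Finset.mul_sum, sum_sphereLinear_sq, mul_smul_comm, mul_one, map_smul,
      smul_eq_mul]
  have := Finset.sum_nonpos fun i (_ : i ∈ Finset.univ) => hsec (stdOrthonormalBasis ℝ E i)
  rw [hsum] at this
  have : 0 < ρ ^ 2 * Λ (sphereExp x₀ ρ η) := by positivity
  linarith

/-- The maximum principle for Λ and -Λ kills the transform on the ball of radius μ; analyticity
along lines through 0 then kills it everywhere. -/
theorem strongDual_sphereExp_eq_zero (x₀ : E) {ρ : ℝ} (hρ : 0 < ρ)
    (Λ : StrongDual ℝ C(sphere x₀ ρ, ℝ)) {μ : ℝ} (hμ : 0 < μ)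
    (h : ∀ ξ : E, ‖ξ‖ = μ → Λ (sphereExp x₀ ρ ξ) = 0) (ξ : E) :
    Λ (sphereExp x₀ ρ ξ) = 0 := by
  have hball : ∀ ξ : E, ‖ξ‖ ≤ μ → Λ (sphereExp x₀ ρ ξ) = 0 := by
    intro ξ hξ
    refine le_antisymm (strongDual_sphereExp_nonpos x₀ hρ Λ h ξ hξ) ?_
    have := strongDual_sphereExp_nonpos x₀ hρ (-Λ) (fun ξ hξ => by simp [h ξ hξ]) ξ hξ
    simpa using this
  have han : AnalyticOnNhd ℝ (fun t : ℝ => Λ (sphereExp x₀ ρ (t • ξ))) Set.univ := by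
    intro t _
    refine (Λ.analyticAt _).comp ?_
    have h1 : AnalyticAt ℝ (fun t : ℝ => sphereLinear x₀ ρ (t • ξ)) t :=
      ((sphereLinear x₀ ρ).analyticAt _).comp (analyticAt_id.smul analyticAt_const)
    exact AnalyticAt.fun_comp (f := fun t : ℝ => sphereLinear x₀ ρ (t • ξ))
      (NormedSpace.exp_analytic (𝕂 := ℝ) (sphereLinear x₀ ρ (t • ξ))) h1
  have hev : (fun t : ℝ => Λ (sphereExp x₀ ρ (t • ξ))) =ᶠ[nhds 0] 0 := by
    have hc : Continuous fun t : ℝ => ‖t • ξ‖ := by fun_prop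
    have : ∀ᶠ t : ℝ in nhds 0, ‖t • ξ‖ < μ := by
      refine hc.continuousAt.eventually_lt_const ?_
      simpa using hμ
    filter_upwards [this] with t ht using hball _ ht.le
  have := han.eqOn_zero_of_preconnected_of_eventuallyEq_zero isPreconnected_univ
    (Set.mem_univ 0) hev (Set.mem_univ 1)
  simpa using this

/-- The exponentials with arbitrary ξ are closed under products and contain 1, so their span is
already the subalgebra they generate, and Stone–Weierstrass applies. -/
theorem strongDual_eq_zero_of_sphereExp (x₀ : E) (ρ : ℝ)
    (Λ : StrongDual ℝ C(sphere x₀ ρ, ℝ)) (h : ∀ ξ : E, Λ (sphereExp x₀ ρ ξ) = 0) : Λ = 0 := by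
  set A := Algebra.adjoin ℝ (Set.range (sphereExp x₀ ρ)) with hA
  have hclos : ∀ a ∈ Submonoid.closure (Set.range (sphereExp x₀ ρ)),
      a ∈ Set.range (sphereExp x₀ ρ) := by
    intro a ha
    induction ha using Submonoid.closure_induction with
    | mem x hx => exact hx
    | one => exact ⟨0, by ext x; simp [sphereExp_apply]⟩
    | mul x y _ _ hx hy =>
      obtain ⟨ξ, rfl⟩ := hx
      obtain ⟨η, rfl⟩ := hy
      exact ⟨ξ + η, sphereExp_add x₀ ρ ξ η⟩
  have hzero : ∀ a ∈ A, Λ a = 0 := by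
    intro a ha
    have ha' : a ∈ Submodule.span ℝ
        (Submonoid.closure (Set.range (sphereExp x₀ ρ)) : Set C(sphere x₀ ρ, ℝ)) := by
      rw [← Algebra.adjoin_eq_span]; exact ha
    clear ha
    induction ha' using Submodule.span_induction with
    | mem x hx =>
      obtain ⟨ξ, rfl⟩ := hclos x hx
      exact h ξ
    | zero => simp
    | add x y _ _ hx hy => rw [map_add, hx, hy, add_zero]
    | smul c x _ hx => rw [map_smul, hx, smul_zero]
  have hsep : A.SeparatesPoints := by
    intro x y hxy
    -- With ξ = x - y the exponents at x and y differ by |x - y|² ≠ 0.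
    refine ⟨_, ⟨sphereExp x₀ ρ ((x : E) - y), Algebra.subset_adjoin ⟨_, rfl⟩, rfl⟩, ?_⟩
    simp only
    rw [sphereExp_apply, sphereExp_apply, Real.exp_injective.ne_iff, ← sub_ne_zero,
      ← inner_sub_right, sub_sub_sub_cancel_right, inner_self_ne_zero, sub_ne_zero]
    exact fun h => hxy (Subtype.ext h)
  have htop := ContinuousMap.subalgebra_topologicalClosure_eq_top_of_separatesPoints A hsep
  ext f
  have hf : f ∈ closure (A : Set C(sphere x₀ ρ, ℝ)) := by
    rw [← Subalgebra.topologicalClosure_coe, htop]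
    trivial
  exact closure_minimal (t := {a | Λ a = 0}) hzero
    (isClosed_eq Λ.continuous continuous_const) hf

/-- The span of the plane waves `x ↦ exp (μ ⟪w, x⟫)` with unit direction `w`. -/
def planeWaveSpan (E : Type*) [NormedAddCommGroup E] [InnerProductSpace ℝ E] (μ : ℝ) :
    Submodule ℝ (E → ℝ) :=
  Submodule.span ℝ {f | ∃ w : E, ‖w‖ = 1 ∧ f = fun x => Real.exp (μ * inner ℝ w x)}

/-- Combinations of plane waves are uniformly dense in the continuous functions on a sphere. -/
theorem exists_planeWaveSpan_approx_on_sphere (x₀ : E) {ρ : ℝ} (hρ : 0 < ρ) {μ : ℝ} (hμ : 0 < μ)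
    (f : E → ℝ) (hf : ContinuousOn f (sphere x₀ ρ)) {ε : ℝ} (hε : 0 < ε) :
    ∃ h ∈ planeWaveSpan E μ, ∀ x ∈ sphere x₀ ρ, |f x - h x| < ε := by
  set T : Submodule ℝ C(sphere x₀ ρ, ℝ) :=
    Submodule.span ℝ {g | ∃ w : E, ‖w‖ = 1 ∧ g = sphereExp x₀ ρ (μ • w)} with hT
  have hTtop : T.topologicalClosure = ⊤ := by
    rw [Submodule.eq_top_iff']
    intro g
    by_contra hg
    obtain ⟨Λ, h1, h2⟩ := T.exists_strongDual_of_notMem_topologicalClosure hg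
    have hΛ : ∀ ξ : E, ‖ξ‖ = μ → Λ (sphereExp x₀ ρ ξ) = 0 := by
      intro ξ hξ
      refine h1 _ (Submodule.subset_span ⟨μ⁻¹ • ξ, ?_, ?_⟩)
      · rw [norm_smul, hξ, norm_inv, Real.norm_of_nonneg hμ.le, inv_mul_cancel₀ hμ.ne']
      · rw [smul_smul, mul_inv_cancel₀ hμ.ne', one_smul]
    have := strongDual_eq_zero_of_sphereExp x₀ ρ Λ (strongDual_sphereExp_eq_zero x₀ hρ Λ hμ hΛ)
    exact h2 (by rw [this]; rfl)
  have hTspan : ∀ g ∈ T, ∃ h ∈ planeWaveSpan E μ, ∀ x : sphere x₀ ρ, g x = h x := by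
    intro g hg
    induction hg using Submodule.span_induction with
    | mem g hg =>
      obtain ⟨w, hw, rfl⟩ := hg
      -- The scalar moves the centre of the exponent from x₀ to the origin.
      refine ⟨Real.exp (-(μ * inner ℝ w x₀)) • fun x => Real.exp (μ * inner ℝ w x),
        Submodule.smul_mem _ _ (Submodule.subset_span ⟨w, hw, rfl⟩), fun x => ?_⟩
      simp only [sphereExp_apply, Pi.smul_apply, smul_eq_mul, ← Real.exp_add, inner_smul_left,
        inner_sub_right]
      congr 1
      simp
      ring
    | zero => exact ⟨0, Submodule.zero_mem _, fun x => rfl⟩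
    | add g₁ g₂ _ _ h₁ h₂ =>
      obtain ⟨f₁, hf₁, e₁⟩ := h₁
      obtain ⟨f₂, hf₂, e₂⟩ := h₂
      exact ⟨f₁ + f₂, Submodule.add_mem _ hf₁ hf₂, fun x => by simp [e₁, e₂]⟩
    | smul c g _ h =>
      obtain ⟨f, hf, e⟩ := h
      exact ⟨c • f, Submodule.smul_mem _ _ hf, fun x => by simp [e]⟩
  let F : C(sphere x₀ ρ, ℝ) := ⟨(sphere x₀ ρ).domRestrict f, hf.domRestrict⟩
  have hF : F ∈ closure (T : Set C(sphere x₀ ρ, ℝ)) := by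
    rw [← Submodule.topologicalClosure_coe, hTtop]
    trivial
  obtain ⟨g, hg, hgF⟩ := Metric.mem_closure_iff.1 hF ε hε
  obtain ⟨h, hh, hgh⟩ := hTspan g hg
  refine ⟨h, hh, fun x hx => ?_⟩
  have := (ContinuousMap.dist_lt_iff hε).1 hgF ⟨x, hx⟩
  rw [hgh ⟨x, hx⟩, Real.dist_eq] at this
  exact this

end Density

/-! ### Approximation on balls and smoothness -/

section PlaneWave

variable {m : ℕ}

theorem exists_linearIsometryEquiv_inner_inner (w₀ w : EuclideanSpace ℝ (Fin m))
    (hw₀ : ‖w₀‖ = 1) (hw : ‖w‖ = 1) :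
    ∃ e : EuclideanSpace ℝ (Fin m) ≃ₗᵢ[ℝ] EuclideanSpace ℝ (Fin m),
      ∀ x, inner ℝ w x = inner ℝ w₀ (e x) := by
  rcases isEmpty_or_nonempty (Fin m) with hm | ⟨⟨i⟩⟩
  · exact ⟨LinearIsometryEquiv.refl ℝ _, fun x => by simp [PiLp.inner_apply]⟩
  · obtain ⟨e₀, he₀⟩ := exists_linearIsometryEquiv_inner i w₀ hw₀
    obtain ⟨e, he⟩ := exists_linearIsometryEquiv_inner i w hw
    exact ⟨e.trans e₀.symm, fun x => by simp [he₀, he]⟩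

theorem contDiff_of_mem_planeWaveSpan {μ : ℝ} {h : EuclideanSpace ℝ (Fin m) → ℝ}
    (hh : h ∈ planeWaveSpan (EuclideanSpace ℝ (Fin m)) μ) {n : WithTop ℕ∞} : ContDiff ℝ n h := by
  induction hh using Submodule.span_induction with
  | mem f hf =>
    obtain ⟨w, -, rfl⟩ := hf
    exact (contDiff_const.mul (contDiff_const.inner ℝ contDiff_id)).exp
  | zero => exact contDiff_const
  | add f g _ _ hf hg => exact hf.add hg
  | smul c f _ hf => exact contDiff_const.smul hf

/-- Plane waves are eigenfunctions of averaging against rotation invariant kernels. -/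
theorem integral_kernel_mul_of_mem_planeWaveSpan {μ : ℝ} {h : EuclideanSpace ℝ (Fin m) → ℝ}
    (hh : h ∈ planeWaveSpan (EuclideanSpace ℝ (Fin m)) μ)
    (k : EuclideanSpace ℝ (Fin m) → ℝ)
    (hk : ∀ (e : EuclideanSpace ℝ (Fin m) ≃ₗᵢ[ℝ] EuclideanSpace ℝ (Fin m)) y, k (e y) = k y)
    (hki : ∀ g : EuclideanSpace ℝ (Fin m) → ℝ, Continuous g → Integrable fun y => k y * g y)
    (w₀ : EuclideanSpace ℝ (Fin m)) (hw₀ : ‖w₀‖ = 1) (x : EuclideanSpace ℝ (Fin m)) :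
    ∫ y, k y * h (x + y) = h x * ∫ y, k y * Real.exp (μ * inner ℝ w₀ y) := by
  induction hh using Submodule.span_induction with
  | mem f hf =>
    obtain ⟨w, hw, rfl⟩ := hf
    -- Rotating w to w₀ leaves k unchanged, so the eigenvalue is the same for every unit direction
    -- and the identity extends linearly to the span.
    obtain ⟨e, he⟩ := exists_linearIsometryEquiv_inner_inner w₀ w hw₀ hw
    rw [← e.measurePreserving.integral_comp e.toHomeomorph.measurableEmbedding
      (fun y => k y * Real.exp (μ * inner ℝ w₀ y)), ← integral_const_mul]
    congr 1
    ext y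
    simp only [hk, ← he, inner_add_right, mul_add, Real.exp_add]
    ring
  | zero => simp
  | add f g hf hg hf' hg' =>
    have h1 := (contDiff_of_mem_planeWaveSpan (n := 0) hf).continuous
    have h2 := (contDiff_of_mem_planeWaveSpan (n := 0) hg).continuous
    simp only [Pi.add_apply, mul_add, add_mul]
    rw [integral_add (hki _ (by fun_prop)) (hki _ (by fun_prop)), hf', hg']
  | smul c f _ hf =>
    simp only [Pi.smul_apply, smul_eq_mul, mul_left_comm _ c]
    rw [integral_const_mul, hf, mul_assoc]

theorem integral_ball_of_mem_planeWaveSpan {μ : ℝ} {h : EuclideanSpace ℝ (Fin m) → ℝ}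
    (hh : h ∈ planeWaveSpan (EuclideanSpace ℝ (Fin m)) μ)
    (w₀ : EuclideanSpace ℝ (Fin m)) (hw₀ : ‖w₀‖ = 1) (x : EuclideanSpace ℝ (Fin m)) (r : ℝ) :
    ∫ y in ball x r, h y = h x * ∫ y in ball 0 r, Real.exp (μ * inner ℝ w₀ y) := by
  have key := integral_kernel_mul_of_mem_planeWaveSpan hh
    ((ball (0 : EuclideanSpace ℝ (Fin m)) r).indicator fun _ => 1)
    (fun e y => by simp [Set.indicator])
    (fun g hg => by
      have : IntegrableOn g (ball 0 r) :=
        (hg.continuousOn.integrableOn_compact (isCompact_closedBall 0 r)).mono_set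
          ball_subset_closedBall
      refine ((integrable_indicator_iff measurableSet_ball).2 this).congr
        (Filter.Eventually.of_forall fun y => ?_)
      simp [Set.indicator]) w₀ hw₀ x
  rw [← integral_indicator measurableSet_ball, ← integral_indicator measurableSet_ball,
    ← integral_add_left_eq_self _ x]
  convert! key using 2
  · ext y
    simp [Set.indicator]
  · congr 1
    ext y
    simp [Set.indicator]

/-- Maximum principle for functions whose averages over small balls exceed the central value by the
factor of a plane wave. -/
theorem le_of_local_ball_average (hm : 1 ≤ m) (w₀ : EuclideanSpace ℝ (Fin m)) (hw₀ : ‖w₀‖ = 1)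
    {μ : ℝ} (hμ : 0 < μ) (u : EuclideanSpace ℝ (Fin m) → ℝ) (x₀ : EuclideanSpace ℝ (Fin m))
    {ρ : ℝ} (hu : ContinuousOn u (closedBall x₀ ρ))
    (hmean : ∀ x ∈ ball x₀ ρ, ∃ δ > 0, ∀ r ∈ Set.Ioo 0 δ, ∫ y in ball x r, u y =
      u x * ∫ y in ball 0 r, Real.exp (μ * inner ℝ w₀ y))
    {ε : ℝ} (hε : 0 ≤ ε) (hbd : ∀ x ∈ sphere x₀ ρ, u x ≤ ε) :
    ∀ x ∈ closedBall x₀ ρ, u x ≤ ε := by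
  intro x hx
  obtain ⟨z, hz, hmax⟩ := (isCompact_closedBall x₀ ρ).exists_isMaxOn ⟨x, hx⟩ hu
  refine (hmax hx : u x ≤ u z).trans ?_
  by_contra! hlt
  have hzb : z ∈ ball x₀ ρ := by
    refine mem_ball.2 (lt_of_le_of_ne (mem_closedBall.1 hz) fun h => ?_)
    exact absurd (hbd z h) (not_le.2 hlt)
  obtain ⟨δ, hδ, hδmean⟩ := hmean z hzb
  obtain ⟨η, hη, hηsub⟩ := Metric.isOpen_iff.1 isOpen_ball z hzb
  have hr : 0 < min δ η / 2 := by positivity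
  have hrδ : min δ η / 2 < δ := by linarith [min_le_left δ η]
  have hrη : min δ η / 2 ≤ η := by linarith [min_le_right δ η]
  have hsub : ball z (min δ η / 2) ⊆ closedBall x₀ ρ :=
    (ball_subset_ball hrη).trans (hηsub.trans ball_subset_closedBall)
  have h1 := hδmean _ ⟨hr, hrδ⟩
  have hint : IntegrableOn u (ball z (min δ η / 2)) :=
    (hu.integrableOn_compact (isCompact_closedBall x₀ ρ)).mono_set hsub
  have h2 : ∫ y in ball z (min δ η / 2), u y ≤ ∫ y in ball z (min δ η / 2), u z :=
    setIntegral_mono_on hint (integrableOn_const measure_ball_lt_top.ne) measurableSet_ball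
      fun y hy => hmax (hsub hy)
  rw [setIntegral_const, smul_eq_mul] at h2
  -- At a positive interior maximum, u z * Q = ∫ u ≤ u z * volume < u z * Q.
  have h3 := volume_ball_lt_integral_exp_inner_ball hm w₀ hw₀ hμ z hr
  have h4 : 0 < u z := hε.trans_lt hlt
  have h5 := mul_lt_mul_of_pos_left h3 h4
  linarith

/-- Approximate v on the bounding sphere only. The difference inherits the ball mean property by
linearity, so the maximum principle for both signs carries the bound inside. -/
theorem exists_planeWaveSpan_approx_on_closedBall (hm : 1 ≤ m) (w₀ : EuclideanSpace ℝ (Fin m))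
    (hw₀ : ‖w₀‖ = 1) {μ : ℝ} (hμ : 0 < μ) (v : EuclideanSpace ℝ (Fin m) → ℝ)
    (x₀ : EuclideanSpace ℝ (Fin m)) {ρ : ℝ} (hρ : 0 < ρ) (hv : ContinuousOn v (closedBall x₀ ρ))
    (hmean : ∀ x ∈ ball x₀ ρ, ∃ δ > 0, ∀ r ∈ Set.Ioo 0 δ, ∫ y in ball x r, v y =
      v x * ∫ y in ball 0 r, Real.exp (μ * inner ℝ w₀ y))
    {ε : ℝ} (hε : 0 < ε) :
    ∃ h ∈ planeWaveSpan (EuclideanSpace ℝ (Fin m)) μ, ∀ x ∈ closedBall x₀ ρ, |v x - h x| ≤ ε := by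
  obtain ⟨h, hh, hbd⟩ := exists_planeWaveSpan_approx_on_sphere x₀ hρ hμ v
    (hv.mono sphere_subset_closedBall) hε
  have hhc : Continuous h := (contDiff_of_mem_planeWaveSpan (n := 0) hh).continuous
  have hmean' : ∀ x ∈ ball x₀ ρ, ∃ δ > 0, ∀ r ∈ Set.Ioo 0 δ, ∫ y in ball x r, (v y - h y) =
      (v x - h x) * ∫ y in ball 0 r, Real.exp (μ * inner ℝ w₀ y) := by
    intro x hx
    obtain ⟨δ, hδ, hδmean⟩ := hmean x hx
    obtain ⟨η, hη, hηsub⟩ := Metric.isOpen_iff.1 isOpen_ball x hx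
    refine ⟨min δ η, lt_min hδ hη, fun r hr => ?_⟩
    have hsub : ball x r ⊆ closedBall x₀ ρ :=
      (ball_subset_ball (hr.2.le.trans (min_le_right _ _))).trans
        (hηsub.trans ball_subset_closedBall)
    have h1 : IntegrableOn v (ball x r) :=
      (hv.integrableOn_compact (isCompact_closedBall x₀ ρ)).mono_set hsub
    have h2 : IntegrableOn h (ball x r) :=
      (hhc.continuousOn.integrableOn_compact (isCompact_closedBall x₀ ρ)).mono_set hsub
    rw [integral_sub h1 h2, hδmean r ⟨hr.1, hr.2.trans_le (min_le_left _ _)⟩,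
      integral_ball_of_mem_planeWaveSpan hh w₀ hw₀, sub_mul]
  refine ⟨h, hh, fun x hx => abs_le.2 ⟨?_, ?_⟩⟩
  · have := le_of_local_ball_average hm w₀ hw₀ hμ (fun y => -(v y - h y)) x₀
      (hv.sub hhc.continuousOn).neg
      (fun x hx => by
        obtain ⟨δ, hδ, hδm⟩ := hmean' x hx
        exact ⟨δ, hδ, fun r hr => by rw [integral_neg, hδm r hr, neg_mul]⟩) hε.le
      (fun y hy => (neg_le_abs _).trans (hbd y hy).le) x hx
    linarith
  · exact le_of_local_ball_average hm w₀ hw₀ hμ (fun y => v y - h y) x₀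
      (hv.sub hhc.continuousOn) hmean' hε.le (fun y hy => (le_abs_self _).trans (hbd y hy).le) x hx

/-- A radial bump function supported in the closed ball of radius `δ`. -/
def radialBump (m : ℕ) (δ : ℝ) (y : EuclideanSpace ℝ (Fin m)) : ℝ :=
  Real.smoothTransition (δ ^ 2 - ‖y‖ ^ 2)

theorem contDiff_radialBump (δ : ℝ) {n : ℕ∞} : ContDiff ℝ n (radialBump m δ) :=
  Real.smoothTransition.contDiff.comp (contDiff_const.sub (contDiff_norm_sq ℝ))

theorem radialBump_eq_zero {δ : ℝ} (hδ : 0 ≤ δ) {y : EuclideanSpace ℝ (Fin m)} (hy : δ ≤ ‖y‖) :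
    radialBump m δ y = 0 :=
  Real.smoothTransition.zero_of_nonpos (by nlinarith)

theorem hasCompactSupport_radialBump {δ : ℝ} (hδ : 0 ≤ δ) :
    HasCompactSupport (radialBump m δ) := by
  refine HasCompactSupport.intro (isCompact_closedBall 0 δ) fun y hy => ?_
  refine radialBump_eq_zero hδ ?_
  rw [mem_closedBall, dist_zero_right, not_le] at hy
  exact hy.le

/-- A locally uniform limit of combinations of plane waves is smooth. -/
theorem contDiffOn_of_planeWaveSpan_approx (w₀ : EuclideanSpace ℝ (Fin m))
    (hw₀ : ‖w₀‖ = 1) {μ : ℝ} (v : EuclideanSpace ℝ (Fin m) → ℝ)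
    (x₀ : EuclideanSpace ℝ (Fin m)) {ρ : ℝ} (hρ : 0 < ρ) (hv : ContinuousOn v (closedBall x₀ ρ))
    (happ : ∀ ε > 0, ∃ h ∈ planeWaveSpan (EuclideanSpace ℝ (Fin m)) μ,
      ∀ x ∈ closedBall x₀ ρ, |v x - h x| ≤ ε) {n : ℕ∞} :
    ContDiffOn ℝ n v (ball x₀ (ρ / 2)) := by
  set ψ := radialBump m (ρ / 2) with hψ
  have hψs : ContDiff ℝ n ψ := contDiff_radialBump _
  have hψc : Continuous ψ := (contDiff_radialBump (n := 0) _).continuous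
  have hψcs : HasCompactSupport ψ := hasCompactSupport_radialBump (by positivity)
  have hψ0 : ∀ y, 0 ≤ ψ y := fun y => Real.smoothTransition.nonneg _
  have hψi : ∀ g : EuclideanSpace ℝ (Fin m) → ℝ, Continuous g → Integrable fun y => ψ y * g y :=
    fun g hg => (hψc.mul hg).integrable_of_hasCompactSupport hψcs.mul_right
  -- The common eigenvalue of averaging against ψ; it is positive, so v can be recovered by dividing
  -- by it.
  set c := ∫ y, ψ y * Real.exp (μ * inner ℝ w₀ y) with hc
  have hcpos : 0 < c := by
    refine Continuous.integral_pos_of_hasCompactSupport_nonneg_nonzero (x := 0)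
      (hψc.mul (by fun_prop)) hψcs.mul_right
      (fun y => mul_nonneg (hψ0 y) (Real.exp_pos _).le) ?_
    refine mul_ne_zero (Real.smoothTransition.pos_of_pos ?_).ne' (Real.exp_pos _).ne'
    rw [norm_zero]
    have : 0 < (ρ / 2) ^ 2 := by positivity
    linarith
  set u := (closedBall x₀ ρ).indicator v with hu
  have hui : Integrable u := (integrable_indicator_iff measurableSet_closedBall).2
    (hv.integrableOn_compact (isCompact_closedBall x₀ ρ))
  have hconv : ContDiff ℝ n (convolution u ψ (ContinuousLinearMap.mul ℝ ℝ) volume) :=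
    hψcs.contDiff_convolution_right _ hui.locallyIntegrable hψs
  have heq : ∀ x ∈ ball x₀ (ρ / 2),
      convolution u ψ (ContinuousLinearMap.mul ℝ ℝ) volume x = c * v x := by
    intro x hx
    have hconvx : convolution u ψ (ContinuousLinearMap.mul ℝ ℝ) volume x =
        ∫ y, ψ y * u (x + y) := by
      -- After the translation the kernel is ψ (-y), which equals ψ y because ψ is radial.
      rw [convolution_def, ← integral_add_left_eq_self _ x]
      congr 1
      ext y
      simp [hψ, radialBump, mul_comm]
    have hui' : Integrable fun y => ψ y * u (x + y) := by
      refine (hui.comp_add_left x).bdd_mul (c := 1) hψc.aestronglyMeasurable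
        (Filter.Eventually.of_forall fun y => ?_)
      rw [Real.norm_of_nonneg (hψ0 y)]
      exact Real.smoothTransition.le_one _
    have hψint : Integrable ψ := hψc.integrable_of_hasCompactSupport hψcs
    have hxb : x ∈ closedBall x₀ ρ :=
      closedBall_subset_closedBall (by linarith) (ball_subset_closedBall hx)
    -- For a plane wave combination h the averaging identity is exact. Replacing v by h costs ε ∫ ψ
    -- under the integral and ε c at x; x + y stays in the ball of radius ρ since both x - x₀ and
    -- the support of ψ have size at most ρ/2.
    have hbound : ∀ ε > 0, |(∫ y, ψ y * u (x + y)) - c * v x| ≤ ε * ((∫ y, ψ y) + c) := by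
      intro ε hε
      obtain ⟨h, hh, hvh⟩ := happ ε hε
      have hhc : Continuous h := (contDiff_of_mem_planeWaveSpan (n := 0) hh).continuous
      have e1 := integral_kernel_mul_of_mem_planeWaveSpan hh ψ
        (fun e y => by simp [hψ, radialBump]) hψi w₀ hw₀ x
      have e2 : |(∫ y, ψ y * u (x + y)) - ∫ y, ψ y * h (x + y)| ≤ ε * ∫ y, ψ y := by
        rw [← integral_sub hui' (hψi (fun y => h (x + y)) (by fun_prop)), ← integral_const_mul,
          ← Real.norm_eq_abs]
        refine norm_integral_le_of_norm_le (hψint.const_mul ε)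
          (Filter.Eventually.of_forall fun y => ?_)
        rw [← mul_sub, norm_mul, Real.norm_of_nonneg (hψ0 y), mul_comm ε]
        rcases lt_or_ge ‖y‖ (ρ / 2) with hy | hy
        · have hxy : x + y ∈ closedBall x₀ ρ := by
            rw [mem_ball, dist_eq_norm] at hx
            rw [mem_closedBall, dist_eq_norm, add_sub_right_comm]
            linarith [norm_add_le (x - x₀) y]
          rw [hu, Set.indicator_of_mem hxy, Real.norm_eq_abs]
          exact mul_le_mul_of_nonneg_left (hvh _ hxy) (hψ0 y)
        · rw [hψ, radialBump_eq_zero (by positivity) hy, zero_mul, zero_mul]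
      have e3 : |(∫ y, ψ y * h (x + y)) - c * v x| ≤ ε * c := by
        rw [e1, ← hc, mul_comm (h x), ← mul_sub, abs_mul, abs_of_pos hcpos, abs_sub_comm,
          mul_comm ε]
        exact mul_le_mul_of_nonneg_left (hvh x hxb) hcpos.le
      have := abs_sub_le (∫ y, ψ y * u (x + y)) (∫ y, ψ y * h (x + y)) (c * v x)
      linarith
    have hψI : 0 ≤ ∫ y, ψ y := integral_nonneg hψ0
    have hz : |(∫ y, ψ y * u (x + y)) - c * v x| ≤ 0 := by
      refine le_of_forall_pos_le_add fun ε hε => ?_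
      have := hbound (ε / ((∫ y, ψ y) + c)) (by positivity)
      rwa [div_mul_cancel₀ _ (by positivity), ← zero_add ε] at this
    rw [hconvx]
    exact sub_eq_zero.1 (abs_nonpos_iff.1 hz)
  refine ((contDiff_const (c := c⁻¹)).mul hconv).contDiffOn.congr fun x hx => ?_
  rw [heq x hx, inv_mul_cancel_left₀ hcpos.ne']

end PlaneWave

/-! ### Laplacians at maxima, of quadratics and of plane waves -/

section LaplacianLemmas

variable {E : Type*} [NormedAddCommGroup E] [InnerProductSpace ℝ E] [FiniteDimensional ℝ E]

theorem laplacian_eq_sum_fderiv_fderiv (f : E → ℝ) (x : E) :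
    Laplacian.laplacian f x = ∑ i, fderiv ℝ (fderiv ℝ f) x (stdOrthonormalBasis ℝ E i)
      (stdOrthonormalBasis ℝ E i) := by
  rw [InnerProductSpace.laplacian_eq_iteratedFDeriv_stdOrthonormalBasis]
  exact Finset.sum_congr rfl fun i _ => by rw [iteratedFDeriv_two_apply]; rfl

theorem IsLocalMax.laplacian_nonpos {f : E → ℝ} {x : E} (h : IsLocalMax f x)
    (hf : ContDiffAt ℝ 2 f x) : Laplacian.laplacian f x ≤ 0 := by
  rw [laplacian_eq_sum_fderiv_fderiv]
  refine Finset.sum_nonpos fun i _ => ?_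
  set e := stdOrthonormalBasis ℝ E i
  have hline : ∀ t : ℝ, HasDerivAt (fun t : ℝ => x + t • e) e t := fun t => by
    simpa using ((hasDerivAt_id t).smul_const e).const_add x
  have hl : Filter.Tendsto (fun t : ℝ => x + t • e) (nhds 0) (nhds x) := by
    simpa using (hline 0).continuousAt.tendsto
  have h1 : IsLocalMax (fun t : ℝ => f (x + t • e)) 0 := by
    simpa [IsLocalMax, IsMaxFilter] using hl.eventually h
  have hd : ∀ᶠ y in nhds x, DifferentiableAt ℝ f y :=
    (hf.eventually (by simp)).mono fun y hy => hy.differentiableAt (by simp)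
  refine h1.second_deriv_nonpos (f' := fun t => fderiv ℝ f (x + t • e) e) ?_ ?_
  · filter_upwards [hl.eventually hd] with t ht
    exact ht.hasFDerivAt.comp_hasDerivAt t (hline t)
  · have h2 : HasFDerivAt (fderiv ℝ f) (fderiv ℝ (fderiv ℝ f) x) x :=
      ((hf.fderiv_right (m := 1) (by norm_num)).differentiableAt one_ne_zero).hasFDerivAt
    have h3 : HasDerivAt (fun t : ℝ => fderiv ℝ f (x + t • e)) (fderiv ℝ (fderiv ℝ f) x e) 0 :=
      HasFDerivAt.comp_hasDerivAt_of_eq (0 : ℝ) h2 (hline 0) (by simp)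
    exact (ContinuousLinearMap.apply ℝ ℝ e).hasFDerivAt.comp_hasDerivAt (0 : ℝ) h3

theorem ContDiffAt.continuousAt_laplacian {f : E → ℝ} {x : E} (hf : ContDiffAt ℝ 2 f x) :
    ContinuousAt (Laplacian.laplacian f) x := by
  rw [InnerProductSpace.laplacian_eq_iteratedFDeriv_stdOrthonormalBasis]
  have := hf.continuousAt_iteratedFDeriv (k := 2) le_rfl
  exact tendsto_finsetSum _ fun i _ => ((ContinuousMultilinearMap.apply ℝ (fun _ : Fin 2 => E) ℝ
    ![stdOrthonormalBasis ℝ E i, stdOrthonormalBasis ℝ E i]).continuous.tendsto _).comp this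

theorem laplacian_norm_sub_sq (x₀ x : E) :
    Laplacian.laplacian (fun y : E => ‖y - x₀‖ ^ 2) x = 2 * Module.finrank ℝ E := by
  have h1 : fderiv ℝ (fun y : E => ‖y - x₀‖ ^ 2) = fun y => (2 : ℝ) • innerSL ℝ (y - x₀) := by
    ext1 y
    have := ((hasStrictFDerivAt_norm_sq (y - x₀)).hasFDerivAt).comp y
      ((hasFDerivAt_id y).sub_const x₀)
    rw [HasFDerivAt.fderiv (f := fun y : E => ‖y - x₀‖ ^ 2) this]
    ext z
    simp
  have h2 : fderiv ℝ (fun y : E => (2 : ℝ) • innerSL ℝ (y - x₀)) x = (2 : ℝ) • innerSL ℝ := by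
    have := ((innerSL ℝ (E := E)).hasFDerivAt.comp x
      ((hasFDerivAt_id x).sub_const x₀)).const_smul (2 : ℝ)
    refine HasFDerivAt.fderiv ?_
    exact this
  rw [laplacian_eq_sum_fderiv_fderiv, h1, h2]
  have h3 : ∀ i, ((2 : ℝ) • innerSL ℝ (stdOrthonormalBasis ℝ E i)) (stdOrthonormalBasis ℝ E i) = 2 := by
    intro i
    simp [innerSL_apply_apply]
  refine (Finset.sum_congr rfl fun i _ => h3 i).trans ?_
  simp [mul_comm]

theorem laplacian_planeWave (μ : ℝ) (w : E) (hw : ‖w‖ = 1) (x : E) :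
    Laplacian.laplacian (fun y : E => Real.exp (μ * inner ℝ w y)) x =
      μ ^ 2 * Real.exp (μ * inner ℝ w x) := by
  set L : E →L[ℝ] ℝ := μ • innerSL ℝ w with hL
  have h0 : ∀ y, HasFDerivAt (fun y : E => Real.exp (μ * inner ℝ w y))
      (Real.exp (μ * inner ℝ w y) • L) y := fun y => (L.hasFDerivAt (x := y)).exp
  have h1 : fderiv ℝ (fun y : E => Real.exp (μ * inner ℝ w y)) =
      fun y => Real.exp (μ * inner ℝ w y) • L := by
    ext1 y
    exact (h0 y).fderiv
  rw [laplacian_eq_sum_fderiv_fderiv, h1, ((h0 x).smul_const L).fderiv]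
  have h2 := (stdOrthonormalBasis ℝ E).sum_sq_inner_left w
  rw [hw] at h2
  simp only [hL, ContinuousLinearMap.smulRight_apply, smul_apply,
    innerSL_apply_apply, smul_eq_mul]
  calc _ = μ ^ 2 * Real.exp (μ * inner ℝ w x) * ∑ i, inner ℝ w (stdOrthonormalBasis ℝ E i) ^ 2 := by
        rw [Finset.mul_sum]
        exact Finset.sum_congr rfl fun i _ => by ring
    _ = _ := by rw [h2]; ring

end LaplacianLemmas

/-! ### The equation for uniform limits of plane waves -/

section Conclusion

variable {m : ℕ}

theorem laplacian_of_mem_planeWaveSpan {μ : ℝ} {h : EuclideanSpace ℝ (Fin m) → ℝ}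
    (hh : h ∈ planeWaveSpan (EuclideanSpace ℝ (Fin m)) μ) (x : EuclideanSpace ℝ (Fin m)) :
    Laplacian.laplacian h x = μ ^ 2 * h x := by
  induction hh using Submodule.span_induction with
  | mem f hf =>
    obtain ⟨w, hw, rfl⟩ := hf
    exact laplacian_planeWave μ w hw x
  | zero =>
    have : Laplacian.laplacian (0 : EuclideanSpace ℝ (Fin m) → ℝ) x = 0 := by
      rw [laplacian_eq_sum_fderiv_fderiv]
      simp
    rw [this]
    simp
  | add f g hf hg hf' hg' =>
    rw [ContDiffAt.laplacian_add (contDiff_of_mem_planeWaveSpan hf).contDiffAt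
      (contDiff_of_mem_planeWaveSpan hg).contDiffAt, hf', hg', Pi.add_apply, mul_add]
  | smul c f hf hf' =>
    rw [InnerProductSpace.laplacian_smul c (contDiff_of_mem_planeWaveSpan hf).contDiffAt, hf',
      Pi.smul_apply, smul_eq_mul, smul_eq_mul, mul_left_comm]

/-- Uniform closeness suffices, without convergence of derivatives. If Δv - μ²v > a > 0 near x₀,
then v - h - κ|y - x₀|² with h close to v has an interior maximum on a small ball, yet a positive
Laplacian there. -/
theorem laplacian_le_of_planeWaveSpan_approx (hm : 1 ≤ m) {μ : ℝ} (hμ : 0 < μ)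
    (v : EuclideanSpace ℝ (Fin m) → ℝ) (x₀ : EuclideanSpace ℝ (Fin m)) {ρ : ℝ} (hρ : 0 < ρ)
    (hv : ContDiffOn ℝ 2 v (ball x₀ ρ))
    (happ : ∀ ε > 0, ∃ h ∈ planeWaveSpan (EuclideanSpace ℝ (Fin m)) μ,
      ∀ x ∈ ball x₀ ρ, |v x - h x| ≤ ε) :
    Laplacian.laplacian v x₀ ≤ μ ^ 2 * v x₀ := by
  by_contra! hlt
  have hcd : ∀ x ∈ ball x₀ ρ, ContDiffAt ℝ 2 v x := fun x hx =>
    hv.contDiffAt (isOpen_ball.mem_nhds hx)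
  have hx₀ : x₀ ∈ ball x₀ ρ := mem_ball_self hρ
  set f : EuclideanSpace ℝ (Fin m) → ℝ := fun x => Laplacian.laplacian v x - μ ^ 2 * v x with hf
  have hfc : ContinuousAt f x₀ := (hcd x₀ hx₀).continuousAt_laplacian.sub
    (continuousAt_const.mul (hcd x₀ hx₀).continuousAt)
  have hf0 : 0 < f x₀ := sub_pos.2 hlt
  set a := f x₀ / 2 with ha
  have hapos : 0 < a := by positivity
  obtain ⟨η, hη, hηa⟩ := Metric.eventually_nhds_iff_ball.1
    (hfc.eventually_const_lt (show a < f x₀ by linarith))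
  set s := min η ρ / 2 with hs
  have hspos : 0 < s := by positivity
  have hsη : s < η := by linarith [min_le_left η ρ]
  have hsρ : s < ρ := by linarith [min_le_right η ρ]
  have hsub : closedBall x₀ s ⊆ ball x₀ ρ := closedBall_subset_ball hsρ
  have hmpos : (0 : ℝ) < m := by exact_mod_cast hm
  -- This makes the Laplacian of κ|y - x₀|² equal to a/2.
  set κ := a / (4 * m) with hκ
  have hκpos : 0 < κ := by positivity
  -- The first bound gives 2ε < κs², keeping the maximum off the boundary; the second bounds μ²|v -
  -- h| by a/4, leaving a Laplacian above a - a/4 - a/2 > 0.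
  set ε := min (κ * s ^ 2 / 4) (a / (4 * μ ^ 2)) with hε
  have hεpos : 0 < ε := by positivity
  have hε1 : ε ≤ κ * s ^ 2 / 4 := min_le_left _ _
  have hε2 : μ ^ 2 * ε ≤ a / 4 := by
    have : ε ≤ a / (4 * μ ^ 2) := min_le_right _ _
    calc μ ^ 2 * ε ≤ μ ^ 2 * (a / (4 * μ ^ 2)) := by gcongr
      _ = a / 4 := by field_simp
  obtain ⟨h, hh, hvh⟩ := happ ε hεpos
  have hhs : ContDiff ℝ 2 h := contDiff_of_mem_planeWaveSpan hh
  set q : EuclideanSpace ℝ (Fin m) → ℝ := fun y => ‖y - x₀‖ ^ 2 with hq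
  have hqs : ContDiff ℝ 2 q := (contDiff_id.sub contDiff_const).norm_sq ℝ
  have hκq : ContDiff ℝ 2 (κ • q) := contDiff_const.smul hqs
  set u := v - h - κ • q with hu
  have hus : ∀ x ∈ ball x₀ ρ, ContDiffAt ℝ 2 u x := fun x hx =>
    ((hcd x hx).sub hhs.contDiffAt).sub hκq.contDiffAt
  obtain ⟨z, hz, hmax⟩ := (isCompact_closedBall x₀ s).exists_isMaxOn
    ⟨x₀, mem_closedBall_self hspos.le⟩
    (fun x hx => (hus x (hsub hx)).continuousAt.continuousWithinAt)
  have hu0 : -ε ≤ u x₀ := by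
    have := (abs_le.1 (hvh x₀ hx₀)).1
    simpa [hu, hq] using this
  have huz : u x₀ ≤ u z := hmax (mem_closedBall_self hspos.le)
  have huz' : u z = v z - h z - κ * ‖z - x₀‖ ^ 2 := rfl
  have hvz := abs_le.1 (hvh z (hsub hz))
  have hzs : dist z x₀ < s := by
    refine lt_of_le_of_ne hz fun heq => ?_
    rw [dist_eq_norm] at heq
    rw [heq] at huz'
    have : 0 < κ * s ^ 2 := by positivity
    linarith [hvz.2]
  have hloc : IsLocalMax u z := hmax.isLocalMax
    (Filter.mem_of_superset (isOpen_ball.mem_nhds hzs) ball_subset_closedBall)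
  have hzρ := hsub hz
  have hlap := hloc.laplacian_nonpos (hus z hzρ)
  have hlapu : Laplacian.laplacian u z =
      Laplacian.laplacian v z - μ ^ 2 * h z - κ * (2 * m) := by
    have hvhz : ContDiffAt ℝ 2 (v - h) z := (hcd z hzρ).sub hhs.contDiffAt
    rw [hu, hvhz.laplacian_sub hκq.contDiffAt,
      ContDiffAt.laplacian_sub (hcd z hzρ) hhs.contDiffAt, laplacian_of_mem_planeWaveSpan hh,
      InnerProductSpace.laplacian_smul κ hqs.contDiffAt, hq, laplacian_norm_sub_sq,
      finrank_euclideanSpace_fin, smul_eq_mul]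
  have hfz : a < f z := hηa z (lt_trans hzs hsη)
  have hκm : κ * (2 * m) = a / 2 := by rw [hκ]; field_simp; norm_num
  have hμv : -(μ ^ 2 * ε) ≤ μ ^ 2 * (v z - h z) := by nlinarith [hvz.1, sq_nonneg μ]
  have hfz' : f z = Laplacian.laplacian v z - μ ^ 2 * v z := rfl
  linarith

theorem laplacian_eq_of_planeWaveSpan_approx (hm : 1 ≤ m) {μ : ℝ} (hμ : 0 < μ)
    (v : EuclideanSpace ℝ (Fin m) → ℝ) (x₀ : EuclideanSpace ℝ (Fin m)) {ρ : ℝ} (hρ : 0 < ρ)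
    (hv : ContDiffOn ℝ 2 v (ball x₀ ρ))
    (happ : ∀ ε > 0, ∃ h ∈ planeWaveSpan (EuclideanSpace ℝ (Fin m)) μ,
      ∀ x ∈ ball x₀ ρ, |v x - h x| ≤ ε) :
    Laplacian.laplacian v x₀ = μ ^ 2 * v x₀ := by
  refine le_antisymm (laplacian_le_of_planeWaveSpan_approx hm hμ v x₀ hρ hv happ) ?_
  have := laplacian_le_of_planeWaveSpan_approx hm hμ (-v) x₀ hρ hv.neg (fun ε hε => by
    obtain ⟨h, hh, hvh⟩ := happ ε hε
    refine ⟨-h, Submodule.neg_mem _ hh, fun x hx => ?_⟩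
    rw [Pi.neg_apply, Pi.neg_apply, neg_sub_neg, abs_sub_comm]
    exact hvh x hx)
  rw [InnerProductSpace.laplacian_neg, Pi.neg_apply, Pi.neg_apply] at this
  linarith

end Conclusion

end

/-! ### The main theorem -/

theorem theorem8 (m : ℕ) (hm : 2 ≤ m) (μ : ℝ) (hμ : 0 < μ)
    (D : Set (EuclideanSpace ℝ (Fin m))) (hDo : IsOpen D) (hDc : IsConnected D)
    (hDb : Bornology.IsBounded D)
    (v : EuclideanSpace ℝ (Fin m) → ℝ) (hv : ContinuousOn v D)
    (R : EuclideanSpace ℝ (Fin m) → ℝ)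
    (hR : ∀ x ∈ D, 0 < R x ∧ Metric.closedBall x (R x) ⊆ D)
    (hmean : ∀ x ∈ D, ∀ r ∈ Set.Ioo 0 (R x),
      (m : ℝ) * besselI ((m : ℝ) / 2) (μ * r) * sphereMean v x r =
        μ * r * besselI (((m : ℝ) - 2) / 2) (μ * r) * ballMean v x r) :
    SolvesModifiedHelmholtz μ v D := by
  have hm1 : 1 ≤ m := by omega
  -- Any unit vector serves as the reference direction.
  let w₀ : EuclideanSpace ℝ (Fin m) := EuclideanSpace.single ⟨0, hm1⟩ 1
  have hw₀ : ‖w₀‖ = 1 := by simp [w₀]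
  have hball : ∀ x ∈ D, ∃ δ > 0, ∀ r ∈ Set.Ioo 0 δ, ∫ y in ball x r, v y =
      v x * ∫ y in ball 0 r, Real.exp (μ * inner ℝ w₀ y) := fun x hx =>
    ⟨R x, (hR x hx).1, setIntegral_ball_eq_of_mean_relation hm1 w₀ hw₀ hμ v x
      (hv.mono (hR x hx).2) (hmean x hx)⟩
  have happ : ∀ x ∈ D, ∀ ε > 0, ∃ h ∈ planeWaveSpan (EuclideanSpace ℝ (Fin m)) μ,
      ∀ y ∈ closedBall x (R x), |v y - h y| ≤ ε := fun x hx ε hε =>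
    exists_planeWaveSpan_approx_on_closedBall hm1 w₀ hw₀ hμ v x (hR x hx).1
      (hv.mono (hR x hx).2) (fun y hy => hball y ((hR x hx).2 (ball_subset_closedBall hy))) hε
  have hsmooth : ∀ x ∈ D, ContDiffOn ℝ 2 v (ball x (R x / 2)) := fun x hx =>
    contDiffOn_of_planeWaveSpan_approx (n := 2) w₀ hw₀ v x (hR x hx).1 (hv.mono (hR x hx).2)
      (happ x hx)
  refine ⟨fun x hx => ?_, fun x hx => sub_eq_zero.2 ?_⟩
  · exact ((hsmooth x hx).contDiffAt
      (isOpen_ball.mem_nhds (mem_ball_self (half_pos (hR x hx).1)))).contDiffWithinAt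
  · refine laplacian_eq_of_planeWaveSpan_approx hm1 hμ v x (half_pos (hR x hx).1)
      (hsmooth x hx) fun ε hε => ?_
    obtain ⟨h, hh, hvh⟩ := happ x hx ε hε
    exact ⟨h, hh, fun y hy => hvh y (closedBall_subset_closedBall
      (by linarith [(hR x hx).1]) (ball_subset_closedBall hy))⟩
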